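/- Let $\Gamma$ be a compact metric graph with finitely many vertices and at least one edge; each edge $e$ is a segment $[0,L_e]$ with $0<L_e<\infty$, loops and multiple edges are allowed, and $\Gamma$ need not be connected. Let $\mathcal H=-\frac{d^2}{dx^2}+V$ act in $L^2(\Gamma)=\bigoplus_e L^2(e)$, where $V\in L^2(\Gamma)$ is real, on the functions that belong to $H^2(e)$ on every edge $e$ and satisfy at each vertex $v$ of degree $d_v$ a self-adjoint vertex condition $A_vF(v)+B_vF'(v)=0$. Here $F(v)$ and $F'(v)$ are the vectors of values and of outgoing derivatives at the $d_v$ edge ends at $v$, the $d_v\times 2d_v$ matrix $(A_v\,B_v)$ has maximal rank, and $A_vB_v^*$ is Hermitian. The $\delta$-type condition at $v$ with coefficient $\alpha_v\in\mathbb R$ is: $f$ is continuous at $v$ and the sum of the outgoing derivatives of $f$ at $v$ equals $\alpha_v f(v)$. Let $\Gamma'$ be obtained from $\Gamma$ by $k\ge 0$ vertex identifications: the vertices of $\Gamma$ are partitioned into nonempty classes, each class is glued into a single vertex of $\Gamma'$, and $k$ is the number of vertices of $\Gamma$ minus the number of classes (for example, $k+1$ vertices are glued into one, or $k$ disjoint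 pairs of vertices are glued pairwise). The edges, their lengths and the potential are unchanged. Every vertex $v$ that is glued to another one has degree at least $1$ and carries in $\Gamma$ a $\delta$-type condition with some coefficient $\alpha_v$, and the vertex of $\Gamma'$ that results from a class $C$ with more than one element carries the $\delta$-type condition with coefficient $\sum_{v\in C}\alpha_v$. At all other vertices the conditions are arbitrary self-adjoint ones, the same in $\Gamma$ and $\Gamma'$. Then the eigenvalues of the Hamiltonian of each of the two graphs are real and of finite multiplicity, and they can be listed, counted with multiplicity, as a non-decreasing sequence, $\lambda_1(\Gamma)\le\lambda_2(\Gamma)\le\cdots$ and $\lambda_1(\Gamma')\le\lambda_2(\Gamma')\le\cdots$ respectively; and for every $n\ge 1$ $$\lambda_n(\Gamma)\le\lambda_n(\Gamma')\le\lambda_{n+k}(\Gamma).$$ -/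

import Mathlib

open MeasureTheory Set

/-- A finite metric graph with vertex set `V` and edge set `E`.  Loops, multiple edges and
disconnected graphs are allowed.  The edge `e` is the segment `[0, length e]`; the bond
`(e, false)` is `e` traversed from coordinate `0`, the bond `(e, true)` is `e` traversed from
coordinate `length e`, and `origin b` is the vertex at which the bond `b` starts. -/
structure MetricGraph (V E : Type*) where
  origin : E × Bool → V
  length : E → ℝ
  length_pos : ∀ e, 0 < length e

namespace MetricGraph

variable {V E : Type*} (G : MetricGraph V E)

/-- The bonds starting at `v` (edge ends at `v`, so that a loop contributes two of them).
Their number is the degree of `v`. -/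
abbrev BondsAt (v : V) : Type _ := {b : E × Bool // G.origin b = v}

/-- Lebesgue measure on the edge `e`. -/
noncomputable def edgeMeasure (e : E) : Measure ℝ := volume.restrict (Icc 0 (G.length e))

/-- The Hilbert space `L²(Γ)`, the orthogonal direct sum of the spaces `L²(e)`. -/
abbrev L2Space [Fintype E] : Type _ := PiLp 2 (fun e : E => Lp ℂ 2 (G.edgeMeasure e))

/-- `u`, restricted to the edge `e`, is the (absolutely continuous) representative of an element
of the Sobolev space `H¹(e)`, and `u'` is its derivative, an element of `L²(e)`. -/
def HasH1Deriv (e : E) (u u' : ℝ → ℂ) : Prop :=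
  MemLp u' 2 (G.edgeMeasure e) ∧
    ∀ x ∈ Icc 0 (G.length e), u x = u 0 + ∫ t in (0 : ℝ)..x, u' t

/-- Values at the edge ends. -/
def boundaryValue (u : E → ℝ → ℂ) : E × Bool → ℂ
  | (e, false) => u e 0
  | (e, true) => u e (G.length e)

/-- Derivatives at the edge ends, taken away from the vertex and into the edge; here `u'` is the
derivative with respect to the coordinate on each edge. -/
def boundaryDeriv (u' : E → ℝ → ℂ) : E × Bool → ℂ
  | (e, false) => u' e 0
  | (e, true) => - u' e (G.length e)

end MetricGraph

/-- A metric graph with a real potential in `L²(Γ)` and with self-adjoint vertex conditions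
`A_v F(v) + B_v F'(v) = 0`: the matrix `(A_v B_v)` has maximal rank and `A_v B_v^*` is
Hermitian. -/
structure QuantumGraph (V E : Type*) [DecidableEq V] [Fintype E] extends MetricGraph V E where
  potential : E → ℝ → ℝ
  potential_memLp : ∀ e, MemLp (potential e) 2 (toMetricGraph.edgeMeasure e)
  A : (v : V) → Matrix (toMetricGraph.BondsAt v) (toMetricGraph.BondsAt v) ℂ
  B : (v : V) → Matrix (toMetricGraph.BondsAt v) (toMetricGraph.BondsAt v) ℂ
  rank_eq : ∀ v, (Matrix.fromCols (A v) (B v)).rank = Fintype.card (toMetricGraph.BondsAt v)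
  isHermitian : ∀ v, (A v * (B v).conjTranspose).IsHermitian

namespace QuantumGraph

variable {V E : Type*} [DecidableEq V] [Fintype E] (Γ : QuantumGraph V E)

/-- The vertex condition at `v`: the pairs of boundary data (values and derivatives at all edge
ends) that satisfy `A_v F(v) + B_v F'(v) = 0`. -/
def vertexCondition (v : V) : Set ((E × Bool → ℂ) × (E × Bool → ℂ)) :=
  {p | (Γ.A v).mulVec (fun b => p.1 b.1) + (Γ.B v).mulVec (fun b => p.2 b.1) = 0}

/-- The vertex condition at `v` is the `δ`-type condition with coefficient `α`: the function is
continuous at `v`, with value `c`, and the outgoing derivatives at `v` add up to `α c`. -/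
def IsDelta (v : V) (α : ℝ) : Prop :=
  ∀ F F' : E × Bool → ℂ, (F, F') ∈ Γ.vertexCondition v ↔
    ∃ c : ℂ, (∀ b : Γ.BondsAt v, F b.1 = c) ∧ ∑ b : Γ.BondsAt v, F' b.1 = α * c

/-- `f` belongs to `H²(e)` for each edge `e` and satisfies all the vertex conditions, and `g` is
`-f'' + V f`.  Here `u e`, `u' e` are the continuous representatives of `f` and of its derivative
on `e`, and `u'' e` is the second derivative. -/
def HamiltonianRel (f g : Γ.L2Space) : Prop :=
  ∃ u u' u'' : E → ℝ → ℂ,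
    (∀ e, f e =ᵐ[Γ.edgeMeasure e] u e) ∧
    (∀ e, Γ.HasH1Deriv e (u e) (u' e)) ∧
    (∀ e, Γ.HasH1Deriv e (u' e) (u'' e)) ∧
    (∀ v, (Γ.boundaryValue u, Γ.boundaryDeriv u') ∈ Γ.vertexCondition v) ∧
    (∀ e, g e =ᵐ[Γ.edgeMeasure e] fun x => - u'' e x + Γ.potential e x * u e x)

theorem intervalIntegrable_of_memLp {e : E} {w : ℝ → ℂ} (hw : MemLp w 2 (Γ.edgeMeasure e))
    {x : ℝ} (hx : x ∈ Icc 0 (Γ.length e)) : IntervalIntegrable w volume 0 x := by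
  have h1 : IntegrableOn w (Icc 0 (Γ.length e)) := by
    have : IsFiniteMeasure (Γ.edgeMeasure e) := by
      unfold MetricGraph.edgeMeasure; infer_instance
    exact hw.integrable (by norm_num)
  rw [intervalIntegrable_iff_integrableOn_Icc_of_le hx.1]
  exact h1.mono_set (Icc_subset_Icc_right hx.2)

theorem HasH1Deriv.add {e : E} {u u' w w' : ℝ → ℂ} (h : Γ.HasH1Deriv e u u')
    (k : Γ.HasH1Deriv e w w') : Γ.HasH1Deriv e (u + w) (u' + w') := by
  refine ⟨h.1.add k.1, fun x hx => ?_⟩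
  have := intervalIntegral.integral_add (Γ.intervalIntegrable_of_memLp h.1 hx)
    (Γ.intervalIntegrable_of_memLp k.1 hx)
  simp only [Pi.add_apply, this]
  rw [h.2 x hx, k.2 x hx]
  ring

theorem HasH1Deriv.smul {e : E} {u u' : ℝ → ℂ} (c : ℂ) (h : Γ.HasH1Deriv e u u') :
    Γ.HasH1Deriv e (c • u) (c • u') := by
  refine ⟨h.1.const_smul c, fun x hx => ?_⟩
  have := intervalIntegral.integral_smul (a := 0) (b := x) (μ := volume) c u'
  simp only [Pi.smul_apply, this]
  rw [h.2 x hx, smul_add]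

theorem boundaryValue_add (u w : E → ℝ → ℂ) :
    Γ.boundaryValue (u + w) = Γ.boundaryValue u + Γ.boundaryValue w := by
  ext ⟨e, b⟩; cases b <;> rfl

theorem boundaryDeriv_add (u w : E → ℝ → ℂ) :
    Γ.boundaryDeriv (u + w) = Γ.boundaryDeriv u + Γ.boundaryDeriv w := by
  ext ⟨e, b⟩; cases b <;> simp [MetricGraph.boundaryDeriv, add_comm]

theorem boundaryValue_smul (c : ℂ) (u : E → ℝ → ℂ) :
    Γ.boundaryValue (c • u) = c • Γ.boundaryValue u := by
  ext ⟨e, b⟩; cases b <;> rfl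

theorem boundaryDeriv_smul (c : ℂ) (u : E → ℝ → ℂ) :
    Γ.boundaryDeriv (c • u) = c • Γ.boundaryDeriv u := by
  ext ⟨e, b⟩; cases b <;> simp [MetricGraph.boundaryDeriv]

theorem vertexCondition_add {v : V} {F F' G G' : E × Bool → ℂ}
    (hp : (F, F') ∈ Γ.vertexCondition v) (hq : (G, G') ∈ Γ.vertexCondition v) :
    (F + G, F' + G') ∈ Γ.vertexCondition v := by
  simp only [vertexCondition, mem_ofPred_eq] at hp hq ⊢
  change (Γ.A v).mulVec ((fun b => F b.1) + (fun b => G b.1)) +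
    (Γ.B v).mulVec ((fun b => F' b.1) + (fun b => G' b.1)) = 0
  rw [Matrix.mulVec_add, Matrix.mulVec_add, add_add_add_comm, hp, hq, add_zero]

theorem vertexCondition_smul {v : V} (c : ℂ) {F F' : E × Bool → ℂ}
    (hp : (F, F') ∈ Γ.vertexCondition v) : (c • F, c • F') ∈ Γ.vertexCondition v := by
  simp only [vertexCondition, mem_ofPred_eq] at hp ⊢
  change (Γ.A v).mulVec (c • (fun b => F b.1)) + (Γ.B v).mulVec (c • (fun b => F' b.1)) = 0
  rw [Matrix.mulVec_smul, Matrix.mulVec_smul, ← smul_add, hp, smul_zero]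

theorem HamiltonianRel.zero : Γ.HamiltonianRel 0 0 := by
  have hz : ∀ e, Γ.HasH1Deriv e (0 : ℝ → ℂ) (0 : ℝ → ℂ) := fun e =>
    ⟨MemLp.zero, fun x _ => by simp⟩
  refine ⟨0, 0, 0, fun e => Lp.coeFn_zero _ _ _, hz, hz, fun v => ?_, fun e => ?_⟩
  · have h1 := Γ.boundaryValue_smul 0 0
    have h2 := Γ.boundaryDeriv_smul 0 0
    rw [zero_smul, zero_smul] at h1 h2
    rw [h1, h2]
    change (Γ.A v).mulVec 0 + (Γ.B v).mulVec 0 = 0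
    simp
  · refine (Lp.coeFn_zero ℂ 2 (Γ.edgeMeasure e)).trans (Filter.Eventually.of_forall fun x => ?_)
    simp

theorem HamiltonianRel.add {f g f₂ g₂ : Γ.L2Space} (h : Γ.HamiltonianRel f g)
    (k : Γ.HamiltonianRel f₂ g₂) : Γ.HamiltonianRel (f + f₂) (g + g₂) := by
  obtain ⟨u, u', u'', hf, h1, h2, hv, hg⟩ := h
  obtain ⟨w, w', w'', kf, k1, k2, kv, kg⟩ := k
  refine ⟨u + w, u' + w', u'' + w'', fun e => ?_, fun e => HasH1Deriv.add Γ (h1 e) (k1 e),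
    fun e => HasH1Deriv.add Γ (h2 e) (k2 e), fun v => ?_, fun e => ?_⟩
  · have h3 : (f + f₂) e =ᵐ[Γ.edgeMeasure e] _ := Lp.coeFn_add (f e) (f₂ e)
    exact h3.trans ((hf e).add (kf e))
  · rw [boundaryValue_add, boundaryDeriv_add]
    exact Γ.vertexCondition_add (hv v) (kv v)
  · have h3 : (g + g₂) e =ᵐ[Γ.edgeMeasure e] _ := Lp.coeFn_add (g e) (g₂ e)
    filter_upwards [h3, hg e, kg e] with x hx hx1 hx2
    rw [hx, Pi.add_apply, hx1, hx2]
    simp only [Pi.add_apply]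
    ring

theorem HamiltonianRel.smul (c : ℂ) {f g : Γ.L2Space} (h : Γ.HamiltonianRel f g) :
    Γ.HamiltonianRel (c • f) (c • g) := by
  obtain ⟨u, u', u'', hf, h1, h2, hv, hg⟩ := h
  refine ⟨c • u, c • u', c • u'', fun e => ?_, fun e => HasH1Deriv.smul Γ c (h1 e),
    fun e => HasH1Deriv.smul Γ c (h2 e), fun v => ?_, fun e => ?_⟩
  · have h3 : (c • f) e =ᵐ[Γ.edgeMeasure e] _ := Lp.coeFn_smul c (f e)
    exact h3.trans ((hf e).const_smul c)
  · rw [boundaryValue_smul, boundaryDeriv_smul]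
    exact Γ.vertexCondition_smul c (hv v)
  · have h3 : (c • g) e =ᵐ[Γ.edgeMeasure e] _ := Lp.coeFn_smul c (g e)
    filter_upwards [h3, hg e] with x hx hx1
    rw [hx, Pi.smul_apply, hx1]
    simp only [Pi.smul_apply, smul_eq_mul]
    ring

/-- The graph `{(f, H f) : f ∈ D(H)}` of the Hamiltonian. -/
def hamiltonianGraph : Submodule ℂ (Γ.L2Space × Γ.L2Space) where
  carrier := {p | Γ.HamiltonianRel p.1 p.2}
  zero_mem' := HamiltonianRel.zero Γ
  add_mem' h k := HamiltonianRel.add Γ h k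
  smul_mem' c _ h := HamiltonianRel.smul Γ c h

theorem HasH1Deriv.ae_eq_zero {e : E} {u u' : ℝ → ℂ} (h : Γ.HasH1Deriv e u u')
    (hu : u =ᵐ[Γ.edgeMeasure e] 0) :
    (∀ x ∈ Icc 0 (Γ.length e), u x = 0) ∧ u' =ᵐ[Γ.edgeMeasure e] 0 := by
  have hL := Γ.length_pos e
  have hL' : Γ.length e ∈ Icc 0 (Γ.length e) := ⟨hL.le, le_rfl⟩
  have hint := Γ.intervalIntegrable_of_memLp h.1 hL'
  have hcont : ContinuousOn u (Icc 0 (Γ.length e)) := by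
    have h0 := intervalIntegral.continuousOn_primitive_interval'
      hint (left_mem_uIcc)
    rw [uIcc_of_le hL.le] at h0
    exact (continuousOn_const.add h0).congr h.2
  have hzero : EqOn u 0 (Icc 0 (Γ.length e)) :=
    Measure.eqOn_Icc_of_ae_eq volume hL.ne hu hcont continuousOn_const
  refine ⟨hzero, ?_⟩
  have hprim : ∀ x ∈ Icc 0 (Γ.length e), ∫ t in (0 : ℝ)..x, u' t = 0 := fun x hx => by
    have h1 := h.2 x hx
    rw [hzero hx, hzero ⟨le_rfl, hL.le⟩] at h1
    simpa using h1.symm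
  have hd := hint.ae_hasDerivAt_integral
  have hne : ∀ᵐ x : ℝ, x ≠ 0 ∧ x ≠ Γ.length e := by
    have h1 : ∀ᵐ x : ℝ, x ≠ 0 := by simp [ae_iff]
    have h2 : ∀ᵐ x : ℝ, x ≠ Γ.length e := by simp [ae_iff]
    exact h1.and h2
  unfold MetricGraph.edgeMeasure
  rw [Filter.EventuallyEq, ae_restrict_iff' measurableSet_Icc]
  filter_upwards [hd, hne] with x hx hxne hxI
  have hxo : x ∈ Ioo 0 (Γ.length e) :=
    ⟨lt_of_le_of_ne hxI.1 hxne.1.symm, lt_of_le_of_ne hxI.2 hxne.2⟩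
  have hx1 := hx (by rw [uIcc_of_le hL.le]; exact hxI) 0 left_mem_uIcc
  have hx2 : HasDerivAt (fun y => ∫ t in (0 : ℝ)..y, u' t) 0 x := by
    refine (hasDerivAt_const x (0 : ℂ)).congr_of_eventuallyEq ?_
    filter_upwards [isOpen_Ioo.mem_nhds hxo] with y hy
    exact hprim y ⟨hy.1.le, hy.2.le⟩
  exact hx1.unique hx2

/-- `H f` is determined by `f`. -/
theorem hamiltonianGraph_functional :
    ∀ p ∈ Γ.hamiltonianGraph, p.1 = 0 → p.2 = 0 := by
  rintro ⟨f, g⟩ ⟨u, u', u'', hf, h1, h2, -, hg⟩ (rfl : f = 0)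
  refine PiLp.ext fun e => Lp.ext ?_
  have hu : u e =ᵐ[Γ.edgeMeasure e] 0 :=
    (hf e).symm.trans (Lp.coeFn_zero ℂ 2 (Γ.edgeMeasure e))
  have hu1 := (HasH1Deriv.ae_eq_zero Γ (h1 e) hu).2
  have hu2 := (HasH1Deriv.ae_eq_zero Γ (h2 e) hu1).2
  filter_upwards [hg e, hu, hu2, Lp.coeFn_zero ℂ 2 (Γ.edgeMeasure e)] with x a b c d
  rw [a, b, c, PiLp.zero_apply, d]
  simp

/-- The Hamiltonian `H = -d²/dx² + V` of the quantum graph, an unbounded operator in `L²(Γ)`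
whose domain consists of the functions that are in `H²(e)` on each edge `e` and satisfy the
vertex conditions. -/
noncomputable def hamiltonian : Γ.L2Space →ₗ.[ℂ] Γ.L2Space :=
  Γ.hamiltonianGraph.toLinearPMap

theorem hamiltonian_graph : Γ.hamiltonian.graph = Γ.hamiltonianGraph :=
  Submodule.toLinearPMap_graph_eq _ Γ.hamiltonianGraph_functional

/-- The kernel of `H - μ`. -/
noncomputable def eigenspace (μ : ℂ) : Submodule ℂ Γ.L2Space :=
  (LinearMap.ker (Γ.hamiltonian.toFun - μ • Γ.hamiltonian.domain.subtype)).map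
    Γ.hamiltonian.domain.subtype

/-- `lam 0 ≤ lam 1 ≤ lam 2 ≤ …` lists all eigenvalues of the Hamiltonian, each repeated according
to its (finite) multiplicity. -/
def IsEigenvalueSequence (lam : ℕ → ℝ) : Prop :=
  Monotone lam ∧ ∀ μ : ℂ, FiniteDimensional ℂ (Γ.eigenspace μ) ∧
    {n : ℕ | (lam n : ℂ) = μ}.encard = Module.finrank ℂ (Γ.eigenspace μ)

/-- `Γ'` is obtained from `Γ` by gluing, for each vertex `w` of `Γ'`, the vertices of `Γ` in the
fibre `q ⁻¹' {w}` into the single vertex `w`.  Edges, lengths and potential are kept.  If `v` is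
glued to some other vertex, then it has at least one edge end, carries the `δ`-type condition with
coefficient `α v`, and the new vertex carries the `δ`-type condition whose coefficient is the sum
of those of the vertices glued together.  A vertex not glued to another keeps its condition. -/
structure IsGluing {V' : Type*} [Fintype V] [DecidableEq V']
    (Γ : QuantumGraph V E) (Γ' : QuantumGraph V' E) (q : V → V') (α : V → ℝ) : Prop where
  surjective : Function.Surjective q
  length_eq : Γ'.length = Γ.length
  origin_eq : ∀ b, Γ'.origin b = q (Γ.origin b)
  potential_eq : Γ'.potential = Γ.potential
  unglued : ∀ v, (∀ w, q w = q v → w = v) → Γ'.vertexCondition (q v) = Γ.vertexCondition v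
  glued : ∀ v w, w ≠ v → q w = q v →
    Nonempty (Γ.BondsAt v) ∧ Γ.IsDelta v (α v) ∧
      Γ'.IsDelta (q v) (∑ x with q x = q v, α x)

end QuantumGraph

/-! The Hamiltonian is governed by the quadratic form `∫ |f'|² + ∫ V |f|²` plus a boundary term, on
the `H¹` functions whose boundary values can be completed to data satisfying the vertex conditions.
A δ-type condition contributes `α_v |f(v)|²`. Gluing δ-type vertices therefore only adds `k` linear
constraints, the equality of the values at the glued vertices, and leaves the form unchanged because
the coefficients add up. Restricting the form domain raises eigenvalues, and a restriction of
codimension `k` raises them by at most `k` places.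

The comparison (`eigenvalue_le_of_boundaryRelation`) plays two halves of the variational principle
against each other. On vectors orthogonal to the first `n` eigenfunctions of one graph, its form is
at least `lam n` times the squared norm (`le_form_of_orthogonal`). Among combinations of the first
`n + d + 1` eigenfunctions of the other graph, a nonzero one satisfies these `n` orthogonality
relations and `d` further constraints (`exists_combination_eigenvectors`), and its energy is at most
`lam' (n + d)` times the squared norm. The gluing enters only through boundary data:
`exists_boundaryRelation` with `d = 0` and `exists_constraints` with `d = k`.

The existence of the eigenvalue sequences comes from the spectral theorem for a compact resolvent
(`exists_isCompactlyInvertible`). Green's formula and the Lagrangian nature of the vertex conditions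
give symmetry. A Sobolev estimate with small weight on the derivative gives semiboundedness, hence
injectivity of `H + γ`. Surjectivity follows from injectivity by counting parameters of the
solutions on the edges, and compactness is Rellich's theorem. -/

/-! ### Linear algebra of the vertex conditions. -/

section BoundarySpace

open scoped Matrix InnerProductSpace ComplexOrder

/-- Since `A Bᴴ = B Aᴴ`, the range of `(Bᴴ, -Aᴴ)` lies in the kernel of `(A B)`. Maximal rank gives
both spaces dimension `n`, so they coincide. -/
theorem Matrix.exists_mulVec_of_rank_fromCols {n : Type*} [Fintype n] [DecidableEq n]
    {A B : Matrix n n ℂ} (hr : (Matrix.fromCols A B).rank = Fintype.card n)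
    (hAB : (A * Bᴴ).IsHermitian) {F F' : n → ℂ} (h : A *ᵥ F + B *ᵥ F' = 0) :
    ∃ x : n → ℂ, F = Bᴴ *ᵥ x ∧ F' = -(Aᴴ *ᵥ x) := by
  set S : (n ⊕ n → ℂ) →ₗ[ℂ] (n → ℂ) := (Matrix.fromCols A B).mulVecLin with hS
  set R : (n → ℂ) →ₗ[ℂ] (n ⊕ n → ℂ) := (Matrix.fromRows Bᴴ (-Aᴴ)).mulVecLin with hR
  have hBA : B * Aᴴ = A * Bᴴ := by
    have := hAB.eq
    rwa [Matrix.conjTranspose_mul, Matrix.conjTranspose_conjTranspose] at this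
  have hle : LinearMap.range R ≤ LinearMap.ker S := by
    rintro _ ⟨x, rfl⟩
    rw [LinearMap.mem_ker, hS, hR]
    simp only [Matrix.mulVecLin_apply, Matrix.mulVec_mulVec, Matrix.fromCols_mul_fromRows,
      Matrix.mul_neg, hBA]
    simp
  have hrR : Module.finrank ℂ (LinearMap.range R) = Fintype.card n := by
    have h1 : (Matrix.fromRows Aᴴ Bᴴ).rank = Fintype.card n := by
      rw [← Matrix.conjTranspose_fromCols_eq_fromRows_conjTranspose,
        Matrix.rank_conjTranspose, hr]
    have hinj : LinearMap.ker R = ⊥ := by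
      have hk : LinearMap.ker (Matrix.fromRows Aᴴ Bᴴ).mulVecLin = ⊥ := by
        have h2 := (Matrix.fromRows Aᴴ Bᴴ).mulVecLin.finrank_range_add_finrank_ker
        rw [← Matrix.rank, h1, Module.finrank_fintype_fun_eq_card] at h2
        exact Submodule.finrank_eq_zero.1 (by omega)
      rw [eq_bot_iff] at hk ⊢
      intro x hx
      apply hk
      rw [LinearMap.mem_ker, hR] at hx
      rw [LinearMap.mem_ker]
      simp only [Matrix.mulVecLin_apply, Matrix.fromRows_mulVec, Matrix.neg_mulVec] at hx ⊢
      have e1 := fun i => congrFun hx (Sum.inl i)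
      have e2 := fun i => congrFun hx (Sum.inr i)
      simp only [Sum.elim_inl, Sum.elim_inr, Pi.zero_apply, Pi.neg_apply, neg_eq_zero] at e1 e2
      ext (i | i)
      · simpa using e2 i
      · simpa using e1 i
    rw [LinearMap.finrank_range_of_inj (LinearMap.ker_eq_bot.1 hinj),
      Module.finrank_fintype_fun_eq_card]
  have hrS : Module.finrank ℂ (LinearMap.ker S) = Fintype.card n := by
    have h2 := S.finrank_range_add_finrank_ker
    rw [hS, ← Matrix.rank, hr, Module.finrank_fintype_fun_eq_card, Fintype.card_sum] at h2
    rw [hS]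
    omega
  have heq := Submodule.eq_of_le_of_finrank_eq hle (hrR.trans hrS.symm)
  have hmem : Sum.elim F F' ∈ LinearMap.ker S := by
    rw [LinearMap.mem_ker, hS, Matrix.mulVecLin_apply, Matrix.fromCols_mulVec]
    simpa using h
  rw [← heq] at hmem
  obtain ⟨x, hx⟩ := hmem
  rw [hR, Matrix.mulVecLin_apply, Matrix.fromRows_mulVec, Matrix.neg_mulVec] at hx
  refine ⟨x, ?_, ?_⟩
  · ext i; exact (congrFun hx (Sum.inl i)).symm
  · ext i; exact (congrFun hx (Sum.inr i)).symm

/-- In the parametrization by `(Bᴴ, -Aᴴ)` both sides reduce to `A Bᴴ = B Aᴴ`. This makes the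
boundary terms of Green's formula cancel. -/
theorem Matrix.star_dotProduct_eq_of_rank_fromCols {n : Type*} [Fintype n] [DecidableEq n]
    {A B : Matrix n n ℂ} (hr : (Matrix.fromCols A B).rank = Fintype.card n)
    (hAB : (A * Bᴴ).IsHermitian) {F F' G G' : n → ℂ} (h : A *ᵥ F + B *ᵥ F' = 0)
    (k : A *ᵥ G + B *ᵥ G' = 0) : star G ⬝ᵥ F' = star G' ⬝ᵥ F := by
  obtain ⟨x, rfl, rfl⟩ := Matrix.exists_mulVec_of_rank_fromCols hr hAB h
  obtain ⟨y, rfl, rfl⟩ := Matrix.exists_mulVec_of_rank_fromCols hr hAB k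
  have hBA : B * Aᴴ = A * Bᴴ := by
    have := hAB.eq
    rwa [Matrix.conjTranspose_mul, Matrix.conjTranspose_conjTranspose] at this
  rw [star_neg, dotProduct_neg, neg_dotProduct, Matrix.star_mulVec, Matrix.star_mulVec,
    Matrix.conjTranspose_conjTranspose, Matrix.conjTranspose_conjTranspose,
    ← Matrix.dotProduct_mulVec, ← Matrix.dotProduct_mulVec, Matrix.mulVec_mulVec,
    Matrix.mulVec_mulVec, hBA]

/-- The form of an isotropic relation: it is given by a symmetric operator. -/
theorem exists_isSymmetric_of_isotropic {W : Type*} [NormedAddCommGroup W]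
    [InnerProductSpace ℂ W] [FiniteDimensional ℂ W] (L : Submodule ℂ (W × W))
    (hL : ∀ p ∈ L, ∀ q ∈ L, ⟪p.2, q.1⟫_ℂ = ⟪p.1, q.2⟫_ℂ) :
    ∃ T : W →ₗ[ℂ] W, T.IsSymmetric ∧ ∀ p ∈ L, ∀ q ∈ L, ⟪p.2, q.1⟫_ℂ = ⟪T p.1, q.1⟫_ℂ := by
  set P : Submodule ℂ W := L.map (LinearMap.fst ℂ W W) with hP
  set π : L →ₗ[ℂ] P := (LinearMap.fst ℂ W W).restrict (p := L) (q := P)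
    (fun x hx => Submodule.mem_map_of_mem hx) with hπ
  have hsurj : Function.Surjective π := by
    rintro ⟨_, y, hy, rfl⟩
    exact ⟨⟨y, hy⟩, rfl⟩
  -- Isotropy puts every `y` with `(0, y) ∈ L` into `Pᗮ`. So any linear section of the first
  -- projection will do, once its second component is compressed to `P`.
  obtain ⟨s, hs⟩ := π.exists_rightInverse_of_surjective (LinearMap.range_eq_top.2 hsurj)
  have hs1 : ∀ x : P, (s x).1.1 = x := fun x => by
    have := congrArg Subtype.val (LinearMap.congr_fun hs x)
    simpa [hπ] using this
  set T : W →ₗ[ℂ] W := P.subtype ∘ₗ P.orthogonalProjectionOnto.toLinearMap ∘ₗ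
    LinearMap.snd ℂ W W ∘ₗ L.subtype ∘ₗ s ∘ₗ P.orthogonalProjectionOnto.toLinearMap with hT
  have hTP : ∀ x y, ⟪T x, y⟫_ℂ =
      ⟪(s (P.orthogonalProjectionOnto x)).1.2, (P.orthogonalProjectionOnto y : W)⟫_ℂ :=
    fun x y => by
    simp only [hT, LinearMap.comp_apply, Submodule.subtype_apply, LinearMap.snd_apply,
      ContinuousLinearMap.coe_coe]
    rw [← Submodule.inner_orthogonalProjectionOnto_eq_of_mem_left,
      Submodule.inner_orthogonalProjectionOnto_eq_of_mem_right]
  refine ⟨T, fun x y => ?_, fun p hp q hq => ?_⟩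
  · rw [hTP, ← inner_conj_symm x, hTP, inner_conj_symm, ← hs1 (P.orthogonalProjectionOnto y),
      hL _ (s _).2 _ (s _).2, hs1]
  · have hpP : p.1 ∈ P := Submodule.mem_map_of_mem hp
    have hqP : q.1 ∈ P := Submodule.mem_map_of_mem hq
    rw [hTP, Submodule.orthogonalProjectionOnto_mem_subspace_eq_self ⟨p.1, hpP⟩,
      Submodule.orthogonalProjectionOnto_mem_subspace_eq_self ⟨q.1, hqP⟩]
    have h1 := hL _ hp _ hq
    have h2 := hL _ (s ⟨p.1, hpP⟩).2 _ hq
    rw [hs1] at h2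
    rw [h1, ← h2]

end BoundarySpace

namespace QuantumGraph

open scoped InnerProductSpace

variable {V E : Type*} [DecidableEq V] [Fintype E] (Γ : QuantumGraph V E)

/-- The boundary data that satisfy all the vertex conditions. -/
def boundaryRelation :
    Submodule ℂ (EuclideanSpace ℂ (E × Bool) × EuclideanSpace ℂ (E × Bool)) where
  carrier := {p | ∀ v, (WithLp.ofLp p.1, WithLp.ofLp p.2) ∈ Γ.vertexCondition v}
  zero_mem' v := by
    change (Γ.A v).mulVec 0 + (Γ.B v).mulVec 0 = 0
    simp
  add_mem' h k v := Γ.vertexCondition_add (h v) (k v)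
  smul_mem' c _ h v := Γ.vertexCondition_smul c (h v)

theorem inner_eq_sum_vertices [Fintype V] (x y : EuclideanSpace ℂ (E × Bool)) :
    ⟪x, y⟫_ℂ = ∑ v, ∑ b : Γ.BondsAt v, star (x b.1) * y b.1 := by
  rw [Fintype.sum_fiberwise Γ.origin (fun b => star (x b) * y b)]
  simp [PiLp.inner_apply, mul_comm]

theorem boundaryRelation_isotropic [Fintype V] : ∀ p ∈ Γ.boundaryRelation,
    ∀ q ∈ Γ.boundaryRelation, ⟪p.2, q.1⟫_ℂ = ⟪p.1, q.2⟫_ℂ := by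
  intro p hp q hq
  rw [Γ.inner_eq_sum_vertices, Γ.inner_eq_sum_vertices]
  refine Finset.sum_congr rfl fun v _ => ?_
  classical
  exact (Matrix.star_dotProduct_eq_of_rank_fromCols (Γ.rank_eq v) (Γ.isHermitian v)
    (hq v) (hp v)).symm

/-- The outgoing derivatives have no meaning for a mere `H¹` function. Replacing them by `T` applied
to the boundary values turns the boundary term into a Hermitian form defined on all `H¹` data. -/
theorem exists_boundaryForm [Fintype V] :
    ∃ T : EuclideanSpace ℂ (E × Bool) →ₗ[ℂ] EuclideanSpace ℂ (E × Bool), T.IsSymmetric ∧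
      ∀ p ∈ Γ.boundaryRelation, ∀ q ∈ Γ.boundaryRelation, ⟪p.2, q.1⟫_ℂ = ⟪T p.1, q.1⟫_ℂ :=
  exists_isSymmetric_of_isotropic _ Γ.boundaryRelation_isotropic

end QuantumGraph

/-! ### Sobolev functions and linear differential equations on an interval. -/

section OneDimensional

theorem AbsolutelyContinuousOnInterval.congr_of_eqOn {X : Type*} [PseudoMetricSpace X]
    {f g : ℝ → X} {a b : ℝ} (hf : AbsolutelyContinuousOnInterval f a b)
    (hfg : EqOn f g (uIcc a b)) : AbsolutelyContinuousOnInterval g a b := by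
  rw [absolutelyContinuousOnInterval_iff] at hf ⊢
  intro ε hε
  obtain ⟨δ, hδ, h⟩ := hf ε hε
  refine ⟨δ, hδ, fun n hn hlt => ?_⟩
  have h1 := h n hn hlt
  convert h1 using 2 with i hi
  rw [hfg (hn.1 i hi).1, hfg (hn.1 i hi).2]

theorem integral_of_hasDerivAt_of_absolutelyContinuous_re_im {L : ℝ} {Φ φ : ℝ → ℂ}
    (hφ : IntervalIntegrable φ volume 0 L)
    (hre : AbsolutelyContinuousOnInterval (fun x => (Φ x).re) 0 L)
    (him : AbsolutelyContinuousOnInterval (fun x => (Φ x).im) 0 L)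
    (hd : ∀ᵐ x, x ∈ uIcc 0 L → HasDerivAt Φ (φ x) x) :
    ∫ x in (0 : ℝ)..L, φ x = Φ L - Φ 0 := by
  have h1 := hre.integral_deriv_eq_sub
  have h2 := him.integral_deriv_eq_sub
  have e1 : ∫ x in (0 : ℝ)..L, deriv (fun x => (Φ x).re) x = ∫ x in (0 : ℝ)..L, (φ x).re := by
    refine intervalIntegral.integral_congr_ae ?_
    filter_upwards [hd] with x hx hxL
    have := Complex.reCLM.hasFDerivAt.comp_hasDerivAt x (hx (uIoc_subset_uIcc hxL))
    exact this.deriv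
  have e2 : ∫ x in (0 : ℝ)..L, deriv (fun x => (Φ x).im) x = ∫ x in (0 : ℝ)..L, (φ x).im := by
    refine intervalIntegral.integral_congr_ae ?_
    filter_upwards [hd] with x hx hxL
    have := Complex.imCLM.hasFDerivAt.comp_hasDerivAt x (hx (uIoc_subset_uIcc hxL))
    exact this.deriv
  have k1 := Complex.reCLM.intervalIntegral_comp_comm hφ
  have k2 := Complex.imCLM.intervalIntegral_comp_comm hφ
  simp only [Complex.reCLM_apply, Complex.imCLM_apply] at k1 k2
  apply Complex.ext
  · rw [← k1, ← e1, h1, Complex.sub_re]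
  · rw [← k2, ← e2, h2, Complex.sub_im]

theorem absolutelyContinuousOnInterval_primitive_re_im {L : ℝ} {f : ℝ → ℂ}
    (hf : IntervalIntegrable f volume 0 L) (a : ℂ) :
    AbsolutelyContinuousOnInterval (fun x => (a + ∫ t in (0 : ℝ)..x, f t).re) 0 L ∧
    AbsolutelyContinuousOnInterval (fun x => (a + ∫ t in (0 : ℝ)..x, f t).im) 0 L := by
  have hr : IntervalIntegrable (fun t => (f t).re) volume 0 L := ⟨hf.1.re, hf.2.re⟩
  have hi : IntervalIntegrable (fun t => (f t).im) volume 0 L := ⟨hf.1.im, hf.2.im⟩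
  have hc : ∀ c : ℝ, AbsolutelyContinuousOnInterval (fun _ : ℝ => c) 0 L := fun c =>
    ((LipschitzWith.const c).lipschitzOnWith (K := 0)).absolutelyContinuousOnInterval
  have hsub : ∀ x ∈ uIcc 0 L, IntervalIntegrable f volume 0 x := fun x hx =>
    hf.mono_set (uIcc_subset_uIcc_left hx)
  constructor
  · have h := (hc a.re).fun_add
      (hr.absolutelyContinuousOnInterval_intervalIntegral (c := 0) left_mem_uIcc)
    refine (AbsolutelyContinuousOnInterval.congr_of_eqOn h) fun x hx => ?_
    have k := Complex.reCLM.intervalIntegral_comp_comm (hsub x hx)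
    simp only [Complex.reCLM_apply] at k
    simp [k]
  · have h := (hc a.im).fun_add
      (hi.absolutelyContinuousOnInterval_intervalIntegral (c := 0) left_mem_uIcc)
    refine (AbsolutelyContinuousOnInterval.congr_of_eqOn h) fun x hx => ?_
    have k := Complex.imCLM.intervalIntegral_comp_comm (hsub x hx)
    simp only [Complex.imCLM_apply] at k
    simp [k]

/-- Integration by parts for primitives of integrable functions. -/
theorem integral_mul_add_mul_of_primitive {L : ℝ} (hL : 0 ≤ L) {u u' w w' : ℝ → ℂ}
    (hu' : IntervalIntegrable u' volume 0 L) (hw' : IntervalIntegrable w' volume 0 L)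
    (hu : ∀ x ∈ Icc 0 L, u x = u 0 + ∫ t in (0 : ℝ)..x, u' t)
    (hw : ∀ x ∈ Icc 0 L, w x = w 0 + ∫ t in (0 : ℝ)..x, w' t) :
    ∫ x in (0 : ℝ)..L, (u' x * w x + u x * w' x) = u L * w L - u 0 * w 0 := by
  set U : ℝ → ℂ := fun x => u 0 + ∫ t in (0 : ℝ)..x, u' t with hU
  set W : ℝ → ℂ := fun x => w 0 + ∫ t in (0 : ℝ)..x, w' t with hW
  have hU' := absolutelyContinuousOnInterval_primitive_re_im hu' (u 0)
  have hW' := absolutelyContinuousOnInterval_primitive_re_im hw' (w 0)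
  have hUc : ContinuousOn U (uIcc 0 L) := continuousOn_const.add
    (intervalIntegral.continuousOn_primitive_interval' hu' left_mem_uIcc)
  have hWc : ContinuousOn W (uIcc 0 L) := continuousOn_const.add
    (intervalIntegral.continuousOn_primitive_interval' hw' left_mem_uIcc)
  have key := integral_of_hasDerivAt_of_absolutelyContinuous_re_im (L := L)
    (Φ := fun x => U x * W x) (φ := fun x => u' x * W x + U x * w' x)
    ((hu'.mul_continuousOn hWc).add (hw'.continuousOn_mul hUc))
    (by
      simp only [Complex.mul_re]
      exact (hU'.1.fun_mul hW'.1).fun_sub (hU'.2.fun_mul hW'.2))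
    (by
      simp only [Complex.mul_im]
      exact (hU'.1.fun_mul hW'.2).fun_add (hU'.2.fun_mul hW'.1))
    (by
      filter_upwards [hu'.ae_hasDerivAt_integral, hw'.ae_hasDerivAt_integral] with x h1 h2 hx
      exact ((h1 hx 0 left_mem_uIcc).const_add (u 0)).mul
        ((h2 hx 0 left_mem_uIcc).const_add (w 0)))
  rw [hu L ⟨hL, le_rfl⟩, hw L ⟨hL, le_rfl⟩]
  have e : ∫ x in (0 : ℝ)..L, (u' x * w x + u x * w' x) =
      ∫ x in (0 : ℝ)..L, (u' x * W x + U x * w' x) := by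
    refine intervalIntegral.integral_congr fun x hx => ?_
    rw [uIcc_of_le hL] at hx
    simp only [hU, hW]
    rw [hu x hx, hw x hx]
  rw [e, key]
  simp [hU, hW]

/-- Cauchy–Schwarz against the constant function, read off from the nonnegativity of `∫ ((b - a) ‖f‖
- S)²` with `S = ∫ ‖f‖`. -/
theorem norm_integral_sq_le {a b : ℝ} (hab : a ≤ b) {f : ℝ → ℂ}
    (hf : MemLp f 2 (volume.restrict (Icc a b))) :
    ‖∫ t in a..b, f t‖ ^ 2 ≤ (b - a) * ∫ t in Icc a b, ‖f t‖ ^ 2 := by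
  have hi : IntegrableOn (fun t => ‖f t‖) (Icc a b) := (hf.integrable (by norm_num)).norm
  have hsq : IntegrableOn (fun t => ‖f t‖ ^ 2) (Icc a b) := hf.integrable_norm_pow (by norm_num)
  set S := ∫ t in Icc a b, ‖f t‖ with hS
  set Q := ∫ t in Icc a b, ‖f t‖ ^ 2 with hQ
  have h1 : ‖∫ t in a..b, f t‖ ≤ S := by
    rw [intervalIntegral.integral_of_le hab, ← integral_Icc_eq_integral_Ioc]
    exact norm_integral_le_integral_norm _
  have h0 : 0 ≤ ∫ t in Icc a b, ((b - a) * ‖f t‖ - S) ^ 2 :=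
    integral_nonneg fun t => sq_nonneg _
  have h2 : ∫ t in Icc a b, ((b - a) * ‖f t‖ - S) ^ 2 =
      (b - a) ^ 2 * Q - 2 * (b - a) * S * S + (b - a) * S ^ 2 := by
    have : ∀ t, ((b - a) * ‖f t‖ - S) ^ 2 =
        (b - a) ^ 2 * ‖f t‖ ^ 2 - 2 * (b - a) * S * ‖f t‖ + S ^ 2 := fun t => by ring
    simp_rw [this]
    rw [integral_add, integral_sub, integral_const_mul, integral_const_mul]
    · simp [hS, hQ, Real.volume_real_Icc_of_le hab]
    · exact hsq.const_mul _
    · exact hi.const_mul _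
    · exact (hsq.const_mul _).sub (hi.const_mul _)
    · exact integrable_const _
  have hS0 : 0 ≤ S := integral_nonneg fun t => norm_nonneg _
  have hQ0 : 0 ≤ Q := integral_nonneg fun t => sq_nonneg _
  have h3 : S ^ 2 ≤ (b - a) * Q := by
    rcases hab.eq_or_lt with rfl | hlt
    · simp [hS]
    · have : 0 ≤ (b - a) * ((b - a) * Q - S ^ 2) := by rw [h2] at h0; nlinarith
      nlinarith [nonneg_of_mul_nonneg_right this (sub_pos.2 hlt)]
  exact (pow_le_pow_left₀ (norm_nonneg _) h1 2).trans h3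

/-- Hölder continuity of exponent 1/2. It yields both the sup bound below and the approximation by
step functions in Rellich's theorem. -/
theorem norm_sub_sq_le_of_primitive {L : ℝ} {u u' : ℝ → ℂ}
    (hu' : MemLp u' 2 (volume.restrict (Icc 0 L)))
    (hu : ∀ x ∈ Icc 0 L, u x = u 0 + ∫ t in (0 : ℝ)..x, u' t) {x y : ℝ}
    (hx : x ∈ Icc 0 L) (hy : y ∈ Icc 0 L) :
    ‖u y - u x‖ ^ 2 ≤ |y - x| * ∫ t in Icc 0 L, ‖u' t‖ ^ 2 := by
  wlog hxy : x ≤ y generalizing x y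
  · rw [norm_sub_rev, abs_sub_comm]
    exact this hy hx (le_of_not_ge hxy)
  have hint : IntegrableOn u' (Icc 0 L) := hu'.integrable (by norm_num)
  have hii : ∀ z ∈ Icc 0 L, IntervalIntegrable u' volume 0 z := fun z hz => by
    rw [intervalIntegrable_iff_integrableOn_Icc_of_le hz.1]
    exact hint.mono_set (Icc_subset_Icc_right hz.2)
  have hsub : Icc x y ⊆ Icc 0 L := Icc_subset_Icc hx.1 hy.2
  have h1 : u y - u x = ∫ t in x..y, u' t := by
    rw [hu y hy, hu x hx, add_sub_add_left_eq_sub,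
      intervalIntegral.integral_interval_sub_left (hii y hy) (hii x hx)]
  rw [h1, abs_of_nonneg (sub_nonneg.2 hxy)]
  refine (norm_integral_sq_le hxy (hu'.mono_measure (Measure.restrict_mono hsub le_rfl))).trans ?_
  refine mul_le_mul_of_nonneg_left ?_ (sub_nonneg.2 hxy)
  exact setIntegral_mono_set (hu'.integrable_norm_pow (by norm_num))
    (Filter.Eventually.of_forall fun t => sq_nonneg _) hsub.eventuallyLE

/-- Compare `u x` with `u y` and average over `y` in a window of length `δ` containing `x`. The
coefficient of the derivative term can be made as small as desired, which is what lets the form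
absorb the potential and the boundary term. -/
theorem norm_sq_le_of_primitive {L δ : ℝ} (hδ : 0 < δ) (hδL : δ ≤ L) {u u' : ℝ → ℂ}
    (hu' : MemLp u' 2 (volume.restrict (Icc 0 L)))
    (hum : MemLp u 2 (volume.restrict (Icc 0 L)))
    (hu : ∀ x ∈ Icc 0 L, u x = u 0 + ∫ t in (0 : ℝ)..x, u' t) {x : ℝ} (hx : x ∈ Icc 0 L) :
    ‖u x‖ ^ 2 ≤ 2 / δ * (∫ t in Icc 0 L, ‖u t‖ ^ 2) + 2 * δ * ∫ t in Icc 0 L, ‖u' t‖ ^ 2 := by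
  set Q := ∫ t in Icc 0 L, ‖u' t‖ ^ 2 with hQ
  have hQ0 : 0 ≤ Q := integral_nonneg fun t => sq_nonneg _
  obtain ⟨a, ha0, haL, hxa⟩ : ∃ a, 0 ≤ a ∧ a + δ ≤ L ∧ x ∈ Icc a (a + δ) := by
    rcases le_total x (L - δ) with h | h
    · exact ⟨x, hx.1, by linarith, le_rfl, by linarith⟩
    · exact ⟨L - δ, by linarith, by linarith, h, by linarith [hx.2]⟩
  have hsub : Icc a (a + δ) ⊆ Icc 0 L := Icc_subset_Icc ha0 haL
  have hsq : IntegrableOn (fun t => ‖u t‖ ^ 2) (Icc 0 L) := hum.integrable_norm_pow (by norm_num)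
  have hpt : ∀ y ∈ Icc a (a + δ), ‖u x‖ ^ 2 ≤ 2 * ‖u y‖ ^ 2 + 2 * δ * Q := fun y hy => by
    have h1 := norm_sub_sq_le_of_primitive hu' hu (hsub hy) hx
    have h2 : |x - y| ≤ δ := by rw [abs_le]; constructor <;> linarith [hxa.1, hxa.2, hy.1, hy.2]
    have h3 : ‖u x - u y‖ ^ 2 ≤ δ * Q := h1.trans (mul_le_mul_of_nonneg_right h2 hQ0)
    have h4 : ‖u x‖ ≤ ‖u y‖ + ‖u x - u y‖ := by
      simpa using norm_add_le (u y) (u x - u y)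
    have h5 : ‖u x‖ ^ 2 ≤ (‖u y‖ + ‖u x - u y‖) ^ 2 := pow_le_pow_left₀ (norm_nonneg _) h4 2
    nlinarith [sq_nonneg (‖u y‖ - ‖u x - u y‖)]
  have hint : ∫ _ in Icc a (a + δ), ‖u x‖ ^ 2 ≤
      ∫ y in Icc a (a + δ), (2 * ‖u y‖ ^ 2 + 2 * δ * Q) :=
    setIntegral_mono_on (integrable_const _)
      (((hsq.mono_set hsub).const_mul 2).add (integrable_const _)) measurableSet_Icc hpt
  rw [integral_add ((hsq.mono_set hsub).const_mul 2) (integrable_const _),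
    integral_const_mul] at hint
  simp only [integral_const, measureReal_restrict_apply MeasurableSet.univ, univ_inter,
    Real.volume_real_Icc_of_le (by linarith : a ≤ a + δ), smul_eq_mul, add_sub_cancel_left] at hint
  have hmono : ∫ y in Icc a (a + δ), ‖u y‖ ^ 2 ≤ ∫ t in Icc 0 L, ‖u t‖ ^ 2 :=
    setIntegral_mono_set hsq (Filter.Eventually.of_forall fun t => sq_nonneg _) hsub.eventuallyLE
  rw [← mul_le_mul_iff_right₀ hδ, mul_add]
  have e : δ * (2 / δ * ∫ t in Icc 0 L, ‖u t‖ ^ 2) = 2 * ∫ t in Icc 0 L, ‖u t‖ ^ 2 := by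
    field_simp
  rw [e]
  linarith

theorem integral_exp_mul_le {β : ℝ} (hβ : 0 < β) (x : ℝ) :
    ∫ y in (0 : ℝ)..x, Real.exp (β * y) ≤ Real.exp (β * x) / β := by
  rw [intervalIntegral.integral_comp_mul_left _ hβ.ne', integral_exp, smul_eq_mul, mul_zero,
    Real.exp_zero, inv_mul_eq_div]
  gcongr
  linarith

/-- Existence for the initial value problem `u'' = q u + r` with integrable `q` and `r`. -/
theorem exists_solution_of_integrable {L : ℝ} (hL : 0 ≤ L) {q r : ℝ → ℂ} (hq : Integrable q)
    (hr : Integrable r) (a b : ℂ) : ∃ u u' : ℝ → ℂ, Continuous u ∧ Continuous u' ∧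
      (∀ x, u x = a + ∫ t in (0 : ℝ)..x, u' t) ∧
      ∀ x ∈ Icc 0 L, u' x = b + ∫ t in (0 : ℝ)..x, (q t * u t + r t) := by
  set Q := ∫ t, ‖q t‖ with hQ
  have hQ0 : 0 ≤ Q := integral_nonneg fun t => norm_nonneg _
  -- Picard iteration for `v = exp (-β t) u`. In this weighted sup norm the second integration gains
  -- a factor `1 / β`, so the contraction constant is `Q / β ≤ 1 / 2` on the whole interval at once.
  set β : ℝ := 2 * Q + 1 with hβ
  have hβ0 : 0 < β := by positivity
  let ext : C(Icc 0 L, ℂ) → ℝ → ℂ := fun v t => (Real.exp (β * t) : ℂ) * IccExtend hL v t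
  have hext : ∀ v, Continuous (ext v) := fun v => by
    have h1 : Continuous (IccExtend hL v) := v.continuous.Icc_extend'
    fun_prop
  have hIccExt : ∀ (v : C(Icc 0 L, ℂ)) (t : ℝ), ‖IccExtend hL v t‖ ≤ ‖v‖ := fun v t =>
    v.norm_coe_le_norm _
  have hint : ∀ v x y, IntervalIntegrable (fun t => q t * ext v t + r t) volume x y :=
    fun v x y => (hq.intervalIntegrable.mul_continuousOn (hext v).continuousOn).add
      hr.intervalIntegrable
  let D : C(Icc 0 L, ℂ) → ℝ → ℂ := fun v y => b + ∫ t in (0 : ℝ)..y, (q t * ext v t + r t)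
  have hD : ∀ v, Continuous (D v) := fun v =>
    continuous_const.add (intervalIntegral.continuous_primitive (hint v) 0)
  let S : C(Icc 0 L, ℂ) → ℝ → ℂ := fun v x => a + ∫ y in (0 : ℝ)..x, D v y
  have hS : ∀ v, Continuous (S v) := fun v => continuous_const.add
    (intervalIntegral.continuous_primitive (fun x y => (hD v).intervalIntegrable x y) 0)
  let T : C(Icc 0 L, ℂ) → C(Icc 0 L, ℂ) := fun v =>
    ⟨fun x => (Real.exp (-(β * x)) : ℂ) * S v x, by have := hS v; fun_prop⟩
  have hDdiff : ∀ v w, ∀ y, 0 ≤ y → ‖D v y - D w y‖ ≤ Real.exp (β * y) * (Q * ‖v - w‖) := by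
    intro v w y hy
    have e : D v y - D w y =
        ∫ t in (0 : ℝ)..y, q t * ((Real.exp (β * t) : ℂ) * IccExtend hL (v - w) t) := by
      simp only [D, add_sub_add_left_eq_sub]
      rw [← intervalIntegral.integral_sub (hint v 0 y) (hint w 0 y)]
      refine intervalIntegral.integral_congr fun t _ => ?_
      simp only [ext, IccExtend, Function.comp_apply, ContinuousMap.sub_apply]
      ring
    have hb : ∀ t ∈ Ioc 0 y, ‖q t * ((Real.exp (β * t) : ℂ) * IccExtend hL (v - w) t)‖ ≤
        ‖q t‖ * (Real.exp (β * y) * ‖v - w‖) := fun t ht => by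
      rw [norm_mul, norm_mul, Complex.norm_real, Real.norm_of_nonneg (Real.exp_pos _).le]
      gcongr
      · exact ht.2
      · exact hIccExt (v - w) t
    rw [e]
    calc _ ≤ ∫ t in (0 : ℝ)..y, ‖q t‖ * (Real.exp (β * y) * ‖v - w‖) :=
          intervalIntegral.norm_integral_le_of_norm_le hy
            (Filter.Eventually.of_forall fun t => hb t) (hq.norm.intervalIntegrable.mul_const _)
      _ = (∫ t in Ioc 0 y, ‖q t‖) * (Real.exp (β * y) * ‖v - w‖) := by
          rw [intervalIntegral.integral_mul_const, intervalIntegral.integral_of_le hy]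
      _ ≤ Q * (Real.exp (β * y) * ‖v - w‖) := by
          gcongr
          exact setIntegral_le_integral hq.norm (Filter.Eventually.of_forall fun t => norm_nonneg _)
      _ = _ := by ring
  have hSdiff : ∀ v w, ∀ x, 0 ≤ x →
      ‖S v x - S w x‖ ≤ Real.exp (β * x) * (2⁻¹ * ‖v - w‖) := by
    intro v w x hx
    have e : S v x - S w x = ∫ y in (0 : ℝ)..x, (D v y - D w y) := by
      simp only [S, add_sub_add_left_eq_sub]
      rw [← intervalIntegral.integral_sub ((hD v).intervalIntegrable 0 x)
        ((hD w).intervalIntegrable 0 x)]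
    rw [e]
    calc _ ≤ ∫ y in (0 : ℝ)..x, Real.exp (β * y) * (Q * ‖v - w‖) :=
          intervalIntegral.norm_integral_le_of_norm_le hx
            (Filter.Eventually.of_forall fun y hy => hDdiff v w y hy.1.le)
            (Continuous.intervalIntegrable (by fun_prop) _ _)
      _ = (∫ y in (0 : ℝ)..x, Real.exp (β * y)) * (Q * ‖v - w‖) := by
          rw [intervalIntegral.integral_mul_const]
      _ ≤ Real.exp (β * x) / β * (Q * ‖v - w‖) := by
          gcongr
          exact integral_exp_mul_le hβ0 x
      _ = Real.exp (β * x) * (Q / β * ‖v - w‖) := by ring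
      _ ≤ _ := by
          gcongr
          rw [div_le_iff₀ hβ0, hβ]
          linarith
  have hT : ContractingWith 2⁻¹ T := by
    refine ⟨by norm_num, LipschitzWith.of_dist_le_mul fun v w => ?_⟩
    rw [dist_eq_norm, dist_eq_norm, ContinuousMap.norm_le _ (by positivity)]
    intro x
    have h1 := hSdiff v w x x.2.1
    have e : (T v - T w) x = (Real.exp (-(β * x)) : ℂ) * (S v x - S w x) := by
      simp only [T, ContinuousMap.sub_apply, ContinuousMap.coe_mk]
      ring
    rw [e, norm_mul, Complex.norm_real, Real.norm_of_nonneg (Real.exp_pos _).le]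
    calc _ ≤ Real.exp (-(β * x)) * (Real.exp (β * x) * (2⁻¹ * ‖v - w‖)) := by gcongr
      _ = _ := by rw [← mul_assoc, ← Real.exp_add]; simp
  have : Nonempty (C(Icc 0 L, ℂ)) := ⟨0⟩
  set v := hT.fixedPoint with hv
  have hfix : T v = v := hT.fixedPoint_isFixedPt
  have hSv : ∀ x ∈ Icc 0 L, S v x = ext v x := fun x hx => by
    have h1 : (Real.exp (-(β * x)) : ℂ) * S v x = v ⟨x, hx⟩ :=
      congrArg (fun w : C(Icc 0 L, ℂ) => w ⟨x, hx⟩) hfix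
    simp only [ext]
    rw [IccExtend_of_mem _ _ hx, ← h1, ← mul_assoc, ← Complex.ofReal_mul, ← Real.exp_add]
    simp
  refine ⟨S v, D v, hS v, hD v, fun x => rfl, fun x hx => ?_⟩
  change b + _ = b + _
  congr 1
  refine intervalIntegral.integral_congr fun t ht => ?_
  rw [uIcc_of_le hx.1] at ht
  simp only [hSv t ⟨ht.1, ht.2.trans hx.2⟩]

end OneDimensional

/-! ### Spectral theorem for symmetric linear relations with compact resolvent. -/

section LinearRelation

open scoped InnerProductSpace ComplexConjugate
open Module Filter Topology

variable {X : Type*} [NormedAddCommGroup X] [InnerProductSpace ℂ X]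

/-- The eigenspace of a linear relation. -/
def relEigenspace (T : Submodule ℂ (X × X)) (μ : ℂ) : Submodule ℂ X :=
  T.comap (LinearMap.prod LinearMap.id (μ • LinearMap.id))

theorem mem_relEigenspace {T : Submodule ℂ (X × X)} {μ : ℂ} {f : X} :
    f ∈ relEigenspace T μ ↔ (f, μ • f) ∈ T := Iff.rfl

/-- A symmetric linear relation that is bounded below by `1 - γ`, such that adding `γ` makes it
surjective with a compact inverse. -/
structure IsCompactlyInvertible (T : Submodule ℂ (X × X)) (γ : ℝ) : Prop where
  symm : ∀ p ∈ T, ∀ q ∈ T, ⟪p.2, q.1⟫_ℂ = ⟪p.1, q.2⟫_ℂ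
  bound : ∀ p ∈ T, ‖p.1‖ ^ 2 ≤ (⟪p.1, p.2 + (γ : ℂ) • p.1⟫_ℂ).re
  surj : ∀ g, ∃ f, (f, g - (γ : ℂ) • f) ∈ T
  functional : ∀ g, ((0 : X), g) ∈ T → g = 0
  totallyBounded : TotallyBounded {f | ∃ g, (f, g) ∈ T ∧ ‖g + (γ : ℂ) • f‖ ≤ 1}

/-- `lam` lists the eigenvalues of a linear relation with multiplicity, in increasing order. -/
def IsRelEigenvalueSequence (T : Submodule ℂ (X × X)) (lam : ℕ → ℝ) : Prop :=
  Monotone lam ∧ ∀ μ : ℂ, FiniteDimensional ℂ (relEigenspace T μ) ∧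
    {n : ℕ | (lam n : ℂ) = μ}.encard = finrank ℂ (relEigenspace T μ)

/-- A type with a real function with finite sublevel sets can be listed in increasing order. -/
theorem exists_equiv_nat_monotone {I : Type*} [Infinite I] (val : I → ℝ)
    (hfin : ∀ c, {i | val i ≤ c}.Finite) : ∃ e : ℕ ≃ I, Monotone (val ∘ e) := by
  have hcount : Countable I := by
    have h1 : (⋃ n : ℕ, {i | val i ≤ n}) = univ := by
      ext i
      simpa using exists_nat_ge (val i)
    rw [← countable_univ_iff, ← h1]
    exact countable_iUnion fun n => (hfin n).countable
  obtain ⟨c, hc⟩ := exists_injective_nat I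
  -- Ties between equal values are broken by an injection into `ℕ`, which makes the order linear.
  -- The position of an element is then the number of its predecessors.
  let key : I → ℝ ×ₗ ℕ := fun i => toLex (val i, c i)
  have hkey : Function.Injective key := fun i j hij => by
    have := congrArg (fun p => (ofLex p).2) hij
    exact hc this
  let _ : LinearOrder I := LinearOrder.lift' key hkey
  have hval : Monotone val := fun i j hij => by
    have h1 : key i ≤ key j := hij
    rcases Prod.Lex.le_iff.1 h1 with h | h
    · exact le_of_lt h
    · exact h.1.le
  have hIic : ∀ i : I, (Iic i).Finite := fun i => (hfin (val i)).subset fun j hj => hval hj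
  let rk : I → ℕ := fun i => (Iio i).ncard
  have hIio : ∀ i : I, (Iio i).Finite := fun i => (hIic i).subset Iio_subset_Iic_self
  have hrk : StrictMono rk := fun i j hij =>
    ncard_lt_ncard ((ssubset_iff_of_subset (Iio_subset_Iio hij.le)).2 ⟨i, hij, lt_irrefl i⟩)
      (hIio j)
  -- Ranks have no gaps: the largest element below `i` has rank exactly one less.
  have hlow : ∀ n i, n ≤ rk i → ∃ j, rk j = n := by
    intro n i
    induction hm : rk i using Nat.strong_induction_on generalizing i with
    | _ m ih =>
      intro hn
      rcases hn.eq_or_lt with rfl | hlt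
      · exact ⟨i, hm⟩
      · have hne : (Iio i).Nonempty := by
          rw [← ncard_pos (hIio i)]
          change 0 < rk i
          omega
        obtain ⟨j, hj, hmax⟩ := (hIio i).exists_maximalFor id _ hne
        have h1 : Iio i ⊆ Iic j := fun x hx => by
          rcases le_total x j with h | h
          · exact h
          · exact hmax hx h
        have h2 : Iio i = insert j (Iio j) := by
          apply subset_antisymm
          · rw [Iio_insert]; exact h1
          · rintro x (rfl | hx)
            · exact hj
            · exact lt_trans (mem_Iio.1 hx) (mem_Iio.1 hj)
        have h3 : rk i = rk j + 1 := by
          change (Iio i).ncard = _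
          rw [h2, ncard_insert_of_notMem (by simp) (hIio j)]
        exact ih (rk j) (by omega) j rfl (by omega)
  have hsurj : Function.Surjective rk := fun n => by
    by_contra hcon
    have hlt : ∀ i, rk i < n := fun i => by
      by_contra h
      exact hcon (hlow n i (not_lt.1 h))
    have : Finite I := Finite.of_injective (fun i => (⟨rk i, hlt i⟩ : Fin n)) fun i j hij =>
      hrk.injective (by simpa using hij)
    exact not_finite I
  let e := (Equiv.ofBijective rk ⟨hrk.injective, hsurj⟩).symm
  refine ⟨e, fun m n hmn => hval ?_⟩
  rw [← hrk.le_iff_le]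
  have he : ∀ n, rk (e n) = n := fun n => (Equiv.ofBijective rk _).apply_symm_apply n
  rw [he, he]
  exact hmn

namespace IsCompactlyInvertible

variable {T : Submodule ℂ (X × X)} {γ : ℝ}

theorem norm_le (h : IsCompactlyInvertible T γ) {f g : X} (hfg : (f, g) ∈ T) :
    ‖f‖ ≤ ‖g + (γ : ℂ) • f‖ := by
  have h1 := h.bound _ hfg
  have h2 : (⟪f, g + (γ : ℂ) • f⟫_ℂ).re ≤ ‖f‖ * ‖g + (γ : ℂ) • f‖ :=
    (Complex.re_le_norm _).trans (norm_inner_le_norm _ _)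
  simp only at h1
  rcases (norm_nonneg f).eq_or_lt with h0 | h0
  · rw [← h0]; exact norm_nonneg _
  · nlinarith

theorem eq_ofReal (h : IsCompactlyInvertible T γ) {μ : ℂ} (hμ : relEigenspace T μ ≠ ⊥) :
    ∃ t : ℝ, μ = t ∧ 1 ≤ t + γ := by
  obtain ⟨f, hf, hf0⟩ := Submodule.exists_mem_ne_zero_of_ne_bot hμ
  rw [mem_relEigenspace] at hf
  have h1 := h.symm _ hf _ hf
  have hne : ⟪f, f⟫_ℂ ≠ 0 := inner_self_ne_zero.2 hf0
  simp only [inner_smul_left, inner_smul_right] at h1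
  have h2 : conj μ = μ := mul_right_cancel₀ hne h1
  obtain ⟨t, ht⟩ := Complex.conj_eq_iff_real.1 h2
  refine ⟨t, ht, ?_⟩
  have h3 := h.bound _ hf
  simp only [← add_smul, inner_smul_right, ht, inner_self_eq_norm_sq_to_K] at h3
  have h4 : 0 < ‖f‖ ^ 2 := by positivity
  have h5 : ((((t : ℂ) + γ) * ((‖f‖ : ℝ) : ℂ) ^ 2)).re = (t + γ) * ‖f‖ ^ 2 := by
    rw [← Complex.ofReal_add, ← Complex.ofReal_pow, ← Complex.ofReal_mul, Complex.ofReal_re]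
  erw [h5] at h3
  nlinarith

/-- The lower bound makes the solution of `(T + γ) f = g` unique, so choosing solutions gives a
linear map, a contraction in fact. The image of the unit ball is contained in the totally bounded
set of the hypothesis. -/
theorem exists_resolvent [CompleteSpace X] (h : IsCompactlyInvertible T γ) :
    ∃ R : X →L[ℂ] X, IsCompactOperator R ∧ (R : X →ₗ[ℂ] X).IsSymmetric ∧
      ∀ f g, (f, g) ∈ T ↔ R (g + (γ : ℂ) • f) = f := by
  choose R hR using h.surj
  have huniq : ∀ f g, (f, g) ∈ T → R (g + (γ : ℂ) • f) = f := fun f g hfg => by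
    have h1 := T.sub_mem (hR (g + (γ : ℂ) • f)) hfg
    have h2 := h.norm_le h1
    rw [← sub_eq_zero, ← norm_le_zero_iff]
    refine h2.trans (le_of_eq ?_)
    rw [norm_eq_zero]
    change (g + (γ : ℂ) • f - (γ : ℂ) • R _ - g) + (γ : ℂ) • (R _ - f) = 0
    rw [smul_sub]
    abel
  let R₀ : X →ₗ[ℂ] X :=
    { toFun := R
      map_add' := fun x y => by
        have h1 := huniq _ _ (T.add_mem (hR x) (hR y))
        simp only at h1
        rw [← h1]
        congr 1
        simp only [smul_add]
        abel
      map_smul' := fun c x => by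
        have h1 := huniq _ _ (T.smul_mem c (hR x))
        simp only at h1
        rw [RingHom.id_apply, ← h1]
        congr 1
        rw [smul_sub, smul_comm c (γ : ℂ)]
        abel }
  have hbd : ∀ x, ‖R₀ x‖ ≤ 1 * ‖x‖ := fun x => by
    have := h.norm_le (hR x)
    rw [one_mul]
    refine this.trans (le_of_eq ?_)
    congr 1
    abel
  refine ⟨R₀.mkContinuous 1 hbd, ?_, ?_, fun f g => ⟨huniq f g, fun hfg => ?_⟩⟩
  · refine (isCompactOperator_iff_image_closedBall_subset_compact
      ((R₀.mkContinuous 1 hbd : X →L[ℂ] X) : X →ₗ[ℂ] X) one_pos).2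
      ⟨closure {f | ∃ g, (f, g) ∈ T ∧ ‖g + (γ : ℂ) • f‖ ≤ 1},
        h.totallyBounded.closure.isCompact_of_isClosed isClosed_closure, ?_⟩
    rintro _ ⟨x, hx, rfl⟩
    refine subset_closure ⟨_, hR x, ?_⟩
    have : x - (γ : ℂ) • R x + (γ : ℂ) • R x = x := by abel
    change ‖x - (γ : ℂ) • R x + (γ : ℂ) • R x‖ ≤ 1
    rw [this]
    simpa using hx
  · intro x y
    have h1 := h.symm _ (hR x) _ (hR y)
    simp only [inner_sub_left, inner_sub_right, inner_smul_left, inner_smul_right,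
      Complex.conj_ofReal] at h1
    change ⟪R x, y⟫_ℂ = ⟪x, R y⟫_ℂ
    linear_combination -h1
  · have := hR (g + (γ : ℂ) • f)
    have e : R (g + (γ : ℂ) • f) = f := hfg
    rw [e, add_sub_cancel_right] at this
    exact this

/-- The eigenspace of `T` at `μ` is that of the resolvent at `(μ + γ)⁻¹`, so the spectral theorem
for compact symmetric operators applies. The resolvent has no kernel because `T` is single-valued.
-/
theorem finiteDimensional_and_iSup [CompleteSpace X] (h : IsCompactlyInvertible T γ) :
    (∀ μ, FiniteDimensional ℂ (relEigenspace T μ)) ∧ (⨆ μ, relEigenspace T μ)ᗮ = ⊥ := by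
  obtain ⟨R, hRc, hRs, hR⟩ := h.exists_resolvent
  have heig : ∀ μ : ℂ, μ + γ ≠ 0 →
      relEigenspace T μ = End.eigenspace (R : X →ₗ[ℂ] X) (μ + γ)⁻¹ := fun μ hμ => by
    ext f
    rw [mem_relEigenspace, hR, ← add_smul, map_smul, End.mem_eigenspace_iff,
      ContinuousLinearMap.coe_coe]
    constructor
    · intro hf
      nth_rw 2 [← hf]
      rw [smul_smul, inv_mul_cancel₀ hμ, one_smul]
    · intro hf
      rw [hf, smul_smul, mul_inv_cancel₀ hμ, one_smul]
  constructor
  · intro μ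
    by_cases hμ : μ + γ = 0
    · have : relEigenspace T μ = ⊥ := by
        by_contra hne
        obtain ⟨t, rfl, ht⟩ := h.eq_ofReal hne
        rw [← Complex.ofReal_add, Complex.ofReal_eq_zero] at hμ
        linarith
      rw [this]
      infer_instance
    · rw [heig μ hμ]
      exact ContinuousLinearMap.finite_dimensional_eigenspace hRc _ (inv_ne_zero hμ)
  · have h1 := ContinuousLinearMap.orthogonalComplement_iSup_eigenspaces_eq_bot hRc hRs
    rw [eq_bot_iff, ← h1]
    refine Submodule.orthogonal_le (iSup_le fun ρ => ?_)
    by_cases hρ : ρ = 0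
    · intro f hf
      rw [hρ, End.mem_eigenspace_iff, zero_smul, ContinuousLinearMap.coe_coe] at hf
      have h2 := (hR 0 f).2 (by simpa using hf)
      rw [h.functional f h2]
      exact zero_mem _
    · have : relEigenspace T (ρ⁻¹ - γ) = End.eigenspace (R : X →ₗ[ℂ] X) ρ := by
        rw [heig _ (by simpa using hρ)]
        simp
      rw [← this]
      exact le_iSup (relEigenspace T) _

end IsCompactlyInvertible

end LinearRelation

/-! ### Eigenvalue sequences, eigenbases and the variational principle. -/

section LinearRelation

open scoped InnerProductSpace ComplexConjugate
open Module Filter Topology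

variable {X : Type*} [NormedAddCommGroup X] [InnerProductSpace ℂ X]

namespace IsCompactlyInvertible

variable {T : Submodule ℂ (X × X)} {γ : ℝ}

theorem inner_eq_zero_of_ne (h : IsCompactlyInvertible T γ) {s t : ℝ} (hst : s ≠ t) {f g : X}
    (hf : f ∈ relEigenspace T s) (hg : g ∈ relEigenspace T t) : ⟪f, g⟫_ℂ = 0 := by
  have h1 : ⟪(s : ℂ) • f, g⟫_ℂ = ⟪f, (t : ℂ) • g⟫_ℂ := h.symm _ hf _ hg
  simp only [inner_smul_left, inner_smul_right, Complex.conj_ofReal] at h1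
  have h2 : ((s : ℂ) - t) * ⟪f, g⟫_ℂ = 0 := by linear_combination h1
  refine (mul_eq_zero.1 h2).resolve_left ?_
  rw [sub_eq_zero]
  exact_mod_cast hst

/-- Eigenvectors scaled so that `‖(T + γ) f‖ = 1` lie in a totally bounded set. Those with
eigenvalue at most `c` have norm at least `(c + γ)⁻¹` and are pairwise orthogonal, hence separated
by that distance. A finite cover by balls of half that radius admits only finitely many. -/
theorem finite_eigenvalues_le (h : IsCompactlyInvertible T γ) (c : ℝ) :
    {t : ℝ | relEigenspace T t ≠ ⊥ ∧ t ≤ c}.Finite := by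
  by_contra hinf
  change Set.Infinite _ at hinf
  have hpos : ∀ t : ℝ, relEigenspace T t ≠ ⊥ → 0 < t + γ := fun t ht => by
    obtain ⟨s, hs, hs1⟩ := h.eq_ofReal ht
    rw [Complex.ofReal_inj.1 hs]
    linarith
  have hunit : ∀ t : ℝ, ∃ f, relEigenspace T t ≠ ⊥ → f ∈ relEigenspace T t ∧ ‖f‖ = (t + γ)⁻¹ := by
    intro t
    by_cases ht : relEigenspace T t ≠ ⊥
    · obtain ⟨f, hf, hf0⟩ := Submodule.exists_mem_ne_zero_of_ne_bot ht
      refine ⟨(((t + γ)⁻¹ / ‖f‖ : ℝ) : ℂ) • f, fun _ => ⟨Submodule.smul_mem _ _ hf, ?_⟩⟩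
      have := hpos t ht
      rw [norm_smul, Complex.norm_real, Real.norm_of_nonneg (by positivity),
        div_mul_cancel₀ _ (norm_ne_zero_iff.2 hf0)]
    · exact ⟨0, fun h => absurd h ht⟩
  choose F hF using hunit
  obtain ⟨t₀, ht₀⟩ := hinf.nonempty
  have hc : 0 < c + γ := by linarith [hpos t₀ ht₀.1, ht₀.2]
  obtain ⟨K, hK, hcov⟩ := Metric.totallyBounded_iff.1 h.totallyBounded ((c + γ)⁻¹ / 2)
    (by positivity)
  have hmem : ∀ t ∈ {t : ℝ | relEigenspace T t ≠ ⊥ ∧ t ≤ c}, ∃ y ∈ K,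
      F t ∈ Metric.ball y ((c + γ)⁻¹ / 2) := fun t ht => by
    have h1 : F t ∈ {f | ∃ g, (f, g) ∈ T ∧ ‖g + (γ : ℂ) • f‖ ≤ 1} := by
      refine ⟨(t : ℂ) • F t, (hF t ht.1).1, ?_⟩
      have hp := hpos t ht.1
      rw [← add_smul, norm_smul, (hF t ht.1).2, ← Complex.ofReal_add, Complex.norm_real,
        Real.norm_of_nonneg hp.le, mul_inv_cancel₀ hp.ne']
    simpa using hcov h1
  choose! y hyK hy using hmem
  obtain ⟨s, hs, t, ht, hst, hyst⟩ := hinf.exists_ne_map_eq_of_mapsTo (f := y) hyK hK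
  have hd : dist (F s) (F t) < (c + γ)⁻¹ := by
    have h1 := hy s hs
    have h2 := hy t ht
    rw [← hyst] at h2
    have := dist_triangle_right (F s) (F t) (y s)
    rw [Metric.mem_ball] at h1 h2
    linarith
  have hinner := h.inner_eq_zero_of_ne hst (hF s hs.1).1 (hF t ht.1).1
  have hn : ‖F s‖ ^ 2 ≤ ‖F s - F t‖ ^ 2 := by
    rw [@norm_sub_sq ℂ, hinner]
    simp only [map_zero, mul_zero, sub_zero]
    nlinarith [norm_nonneg (F t)]
  have h3 := abs_le_of_sq_le_sq' hn (norm_nonneg _)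
  rw [dist_eq_norm] at hd
  have h4 : (c + γ)⁻¹ ≤ (s + γ)⁻¹ := inv_anti₀ (hpos s hs.1) (by linarith [hs.2])
  rw [(hF s hs.1).2] at h3
  linarith [h3.2]

/-- List the pairs of an eigenvalue and an index below its multiplicity by increasing eigenvalue.
Finitely many pairs would make the span of the eigenspaces finite-dimensional; its orthogonal
complement being zero, it would be all of `X`. -/
theorem exists_eigenvalueSequence [CompleteSpace X] (h : IsCompactlyInvertible T γ)
    (hX : ¬ FiniteDimensional ℂ X) : ∃ lam, IsRelEigenvalueSequence T lam := by
  obtain ⟨hfd, hsup⟩ := h.finiteDimensional_and_iSup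
  let S := {t : ℝ // relEigenspace T t ≠ ⊥}
  let I := Σ t : S, Fin (finrank ℂ (relEigenspace T (t.1 : ℂ)))
  let val : I → ℝ := fun i => i.1.1
  have hfinS : ∀ c : ℝ, {t : S | t.1 ≤ c}.Finite := fun c => by
    refine Finite.of_finite_image (f := Subtype.val) ?_ Subtype.val_injective.injOn
    refine (h.finite_eigenvalues_le c).subset ?_
    rintro _ ⟨t, ht, rfl⟩
    exact ⟨t.2, ht⟩
  have hfin : ∀ c : ℝ, {i | val i ≤ c}.Finite := fun c => by
    have : {i | val i ≤ c} = ⋃ t ∈ {t : S | t.1 ≤ c}, range (Sigma.mk t : _ → I) := by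
      ext ⟨t, j⟩
      simp only [mem_ofPred_eq, mem_iUnion, mem_range, exists_prop, val]
      constructor
      · intro ht
        exact ⟨t, ht, j, rfl⟩
      · rintro ⟨s, hs, k, hk⟩
        rw [← show s = t from congrArg Sigma.fst hk]
        exact hs
    rw [this]
    exact (hfinS c).biUnion fun t _ => finite_range _
  have hinf : Infinite I := by
    by_contra hI
    rw [not_infinite_iff_finite] at hI
    have hS : Finite S := Finite.of_injective (β := I)
      (fun t => ⟨t, ⟨0, Nat.pos_of_ne_zero fun h0 => t.2 (by
        have := hfd (t.1 : ℂ)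
        exact Submodule.finrank_eq_zero.1 h0)⟩⟩) fun s t hst => congrArg Sigma.fst hst
    have hle : (⨆ μ, relEigenspace T μ) ≤ ⨆ t : S, relEigenspace T (t.1 : ℂ) := by
      refine iSup_le fun μ => ?_
      by_cases hμ : relEigenspace T μ = ⊥
      · rw [hμ]; exact bot_le
      · obtain ⟨t, rfl, -⟩ := h.eq_ofReal hμ
        exact le_iSup (fun t : S => relEigenspace T (t.1 : ℂ)) ⟨t, hμ⟩
    have hfd' : FiniteDimensional ℂ (⨆ t : S, relEigenspace T (t.1 : ℂ) : Submodule ℂ X) :=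
      inferInstance
    have htop : (⨆ t : S, relEigenspace T (t.1 : ℂ)) = ⊤ := by
      rw [← Submodule.orthogonal_eq_bot_iff, eq_bot_iff]
      exact (Submodule.orthogonal_le hle).trans hsup.le
    rw [htop] at hfd'
    exact hX (Module.Finite.equiv (Submodule.topEquiv (R := ℂ) (M := X)))
  obtain ⟨e, he⟩ := exists_equiv_nat_monotone val hfin
  refine ⟨val ∘ e, he, fun μ => ⟨hfd μ, ?_⟩⟩
  by_cases hμ : relEigenspace T μ = ⊥
  · rw [hμ, finrank_bot]
    rw [Nat.cast_zero, encard_eq_zero, eq_empty_iff_forall_notMem]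
    rintro n rfl
    exact (e n).1.2 hμ
  · obtain ⟨t, rfl, -⟩ := h.eq_ofReal hμ
    have h1 : {n : ℕ | (((val ∘ e) n : ℝ) : ℂ) = t} =
        e ⁻¹' range (Sigma.mk ⟨t, hμ⟩ : _ → I) := by
      ext n
      simp only [Function.comp_apply, Complex.ofReal_inj, mem_ofPred_eq, mem_preimage, mem_range]
      constructor
      · intro hn
        rcases hen : e n with ⟨⟨s, hs⟩, j⟩
        rw [hen] at hn
        obtain rfl : s = t := hn
        exact ⟨j, rfl⟩
      · rintro ⟨j, hj⟩
        rw [← hj]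
    rw [h1, encard_preimage_of_bijective e.bijective, ← image_univ,
      (sigma_mk_injective).encard_image, encard_univ]
    simp

/-- The indices `n` with `lam n = t` are as many as the dimension of the eigenspace at `t`, so they
can be matched with an orthonormal basis of it. -/
theorem exists_orthonormal_eigenvectors [CompleteSpace X] (h : IsCompactlyInvertible T γ)
    {lam : ℕ → ℝ} (hlam : IsRelEigenvalueSequence T lam) :
    ∃ φ : ℕ → X, Orthonormal ℂ φ ∧ (∀ n, (φ n, (lam n : ℂ) • φ n) ∈ T) ∧
      (Submodule.span ℂ (range φ))ᗮ = ⊥ := by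
  obtain ⟨hfd, hsup⟩ := h.finiteDimensional_and_iSup
  have hσ : ∀ t : ℝ,
      Nonempty ({n : ℕ | lam n = t} ≃ Fin (finrank ℂ (relEigenspace T (t : ℂ)))) := by
    intro t
    have h1 := (hlam.2 t).2
    simp only [Complex.ofReal_inj] at h1
    have hf : {n : ℕ | lam n = t}.Finite := finite_of_encard_eq_coe h1
    have := hf.to_subtype
    refine ⟨Finite.equivFinOfCardEq ?_⟩
    rw [Nat.card_coe_set_eq, ncard, h1, ENat.toNat_natCast]
  have σ := fun t => (hσ t).some
  have b : ∀ t : ℝ, OrthonormalBasis (Fin (finrank ℂ (relEigenspace T (t : ℂ)))) ℂ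
      (relEigenspace T (t : ℂ)) := fun t => stdOrthonormalBasis ℂ _
  let φ : ℕ → X := fun n => b (lam n) (σ (lam n) ⟨n, rfl⟩)
  have hφ : ∀ t n (hn : lam n = t), φ n = b t (σ t ⟨n, hn⟩) := by
    rintro t n rfl
    rfl
  refine ⟨φ, ⟨fun n => ?_, fun m n hmn => ?_⟩, fun n => ?_, ?_⟩
  · have := (b (lam n)).orthonormal.1 (σ (lam n) ⟨n, rfl⟩)
    exact this
  · change ⟪φ m, φ n⟫_ℂ = 0
    by_cases hl : lam m = lam n
    · rw [hφ _ m hl, hφ _ n rfl]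
      have := (b (lam n)).orthonormal.2 (i := σ (lam n) ⟨m, hl⟩) (j := σ (lam n) ⟨n, rfl⟩)
        fun hij => hmn (by simpa using (σ (lam n)).injective hij)
      exact this
    · exact h.inner_eq_zero_of_ne hl (Subtype.property _) (Subtype.property _)
  · exact (b (lam n) (σ (lam n) ⟨n, rfl⟩)).2
  · rw [eq_bot_iff, ← hsup]
    refine Submodule.orthogonal_le (iSup_le fun μ => ?_)
    by_cases hμ : relEigenspace T μ = ⊥
    · rw [hμ]; exact bot_le
    · obtain ⟨t, rfl, -⟩ := h.eq_ofReal hμ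
      intro f hf
      have h1 := congrArg Subtype.val ((b t).sum_repr ⟨f, hf⟩)
      simp only [AddSubmonoidClass.coe_finsetSum, SetLike.val_smul] at h1
      rw [← h1]
      refine Submodule.sum_mem _ fun j _ => Submodule.smul_mem _ _ (Submodule.subset_span ?_)
      obtain ⟨⟨n, hn⟩, hj⟩ := (σ t).surjective j
      refine ⟨n, ?_⟩
      rw [hφ t n hn, hj]

end IsCompactlyInvertible

/-- Lower half of the variational principle: a form that is bounded below is bounded below by
`lam n` on the vectors orthogonal to the first `n` eigenvectors. -/
theorem le_form_of_orthogonal [CompleteSpace X] {W : Type*} [AddCommGroup W] [Module ℂ W]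
    (J : W →ₗ[ℂ] X) (a : W →ₗ⋆[ℂ] W →ₗ[ℂ] ℂ) (hherm : ∀ v w, conj (a v w) = a w v) (C : ℝ)
    (hC : ∀ w, -C * ‖J w‖ ^ 2 ≤ (a w w).re) {φ : ℕ → X} (hφ : Orthonormal ℂ φ)
    (hcompl : (Submodule.span ℂ (range φ))ᗮ = ⊥) {lam : ℕ → ℝ} (hlam : Monotone lam)
    (Φ : ℕ → W) (hJ : ∀ n, J (Φ n) = φ n) (ha : ∀ n w, a (Φ n) w = lam n * ⟪φ n, J w⟫_ℂ)
    {n : ℕ} {w : W} (hw : ∀ m < n, ⟪φ m, J w⟫_ℂ = 0) : lam n * ‖J w‖ ^ 2 ≤ (a w w).re := by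
  set c : ℕ → ℂ := fun m => ⟪φ m, J w⟫_ℂ with hc
  -- The remainder of the eigenvector expansion, taken in `W`. The weak eigenvalue equation `ha`
  -- makes both the norm and the form split along it.
  let r : ℕ → W := fun N => w - ∑ m ∈ Finset.range N, c m • Φ m
  have hr : ∀ N, r (N + 1) = r N - c N • Φ N := fun N => by
    simp only [r, Finset.sum_range_succ]
    abel
  have hφφ : ∀ m n, ⟪φ m, φ n⟫_ℂ = if m = n then 1 else 0 := orthonormal_iff_ite.1 hφ
  have hcr : ∀ N, ⟪φ N, J (r N)⟫_ℂ = c N := fun N => by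
    simp only [r, map_sub, map_sum, map_smul, inner_sub_right, inner_sum, inner_smul_right, hJ, hφφ]
    rw [Finset.sum_eq_zero fun m hm => ?_, sub_zero]
    rw [if_neg (Finset.mem_range.1 hm).ne', mul_zero]
  have hnorm : ∀ N, ‖J (r N)‖ ^ 2 = ‖J w‖ ^ 2 - ∑ m ∈ Finset.range N, ‖c m‖ ^ 2 := fun N => by
    induction N with
    | zero => simp [r]
    | succ N ih =>
      rw [hr, map_sub, map_smul, hJ, @norm_sub_sq ℂ, ih, Finset.sum_range_succ, norm_smul,
        hφ.1 N, inner_smul_right, ← inner_conj_symm, hcr, Complex.mul_conj]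
      simp only [Complex.normSq_eq_norm_sq, RCLike.re_to_complex, Complex.ofReal_re]
      ring
  have hform : ∀ N, (a (r N) (r N)).re =
      (a w w).re - ∑ m ∈ Finset.range N, lam m * ‖c m‖ ^ 2 := fun N => by
    induction N with
    | zero => simp [r]
    | succ N ih =>
      have e : a (r (N + 1)) (r (N + 1)) = a (r N) (r N) - (lam N : ℂ) * (c N * conj (c N)) := by
        rw [hr]
        simp only [map_sub, map_smul, LinearMap.sub_apply, map_smulₛₗ,
          LinearMap.smul_apply, smul_eq_mul]
        rw [← hherm (Φ N) (r N)]
        simp only [ha, hcr, hJ, hφφ, if_true, map_mul, Complex.conj_ofReal]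
        ring
      rw [e, Finset.sum_range_succ, Complex.sub_re, ih, Complex.mul_conj,
        Complex.normSq_eq_norm_sq, ← Complex.ofReal_mul, Complex.ofReal_re]
      ring
  have hsum : HasSum (fun m => ‖c m‖ ^ 2) (‖J w‖ ^ 2) := by
    let B := HilbertBasis.mkOfOrthogonalEqBot hφ hcompl
    have h1 := B.hasSum_inner_mul_inner (J w) (J w)
    have h2 := Complex.hasSum_re h1
    convert h2 using 1
    · ext m
      have : B m = φ m := by simp [B]
      rw [this, ← inner_conj_symm, mul_comm, Complex.mul_conj, Complex.normSq_eq_norm_sq,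
        Complex.ofReal_re]
    · rw [inner_self_eq_norm_sq_to_K]
      norm_cast
  have hlim := hsum.tendsto_sum_nat
  -- The form of the remainder is only known to be at least `-C` times its squared norm, but that
  -- norm tends to zero. So neither convergence in the form norm nor closedness of the form is
  -- needed.
  have hineq : ∀ N, -C * (‖J w‖ ^ 2 - ∑ m ∈ Finset.range N, ‖c m‖ ^ 2) +
      lam n * ∑ m ∈ Finset.range N, ‖c m‖ ^ 2 ≤ (a w w).re := fun N => by
    have h1 := hC (r N)
    rw [hnorm, hform] at h1
    have h2 : lam n * ∑ m ∈ Finset.range N, ‖c m‖ ^ 2 ≤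
        ∑ m ∈ Finset.range N, lam m * ‖c m‖ ^ 2 := by
      rw [Finset.mul_sum]
      refine Finset.sum_le_sum fun m _ => ?_
      rcases lt_or_ge m n with hm | hm
      · have : c m = 0 := hw m hm
        simp [this]
      · exact mul_le_mul_of_nonneg_right (hlam hm) (sq_nonneg _)
    linarith
  have hl2 : Tendsto (fun N => -C * (‖J w‖ ^ 2 - ∑ m ∈ Finset.range N, ‖c m‖ ^ 2) +
      lam n * ∑ m ∈ Finset.range N, ‖c m‖ ^ 2) atTop
      (𝓝 (-C * (‖J w‖ ^ 2 - ‖J w‖ ^ 2) + lam n * ‖J w‖ ^ 2)) :=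
    ((tendsto_const_nhds.sub hlim).const_mul _).add (hlim.const_mul _)
  have := le_of_tendsto' hl2 hineq
  simpa using this

/-- Combinations of the first `N + 1` eigenvectors that satisfy `N` linear conditions. -/
theorem exists_combination_eigenvectors {T : Submodule ℂ (X × X)} {φ : ℕ → X}
    (hφ : Orthonormal ℂ φ) {lam : ℕ → ℝ} (hlam : Monotone lam)
    (hT : ∀ n, (φ n, (lam n : ℂ) • φ n) ∈ T) {N : ℕ} {Y : Type*} [AddCommGroup Y] [Module ℂ Y]
    [FiniteDimensional ℂ Y] (hY : finrank ℂ Y ≤ N) (l : (Fin (N + 1) → ℂ) →ₗ[ℂ] Y) :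
    ∃ z : Fin (N + 1) → ℂ, l z = 0 ∧ (∑ i, z i • φ i) ≠ 0 ∧
      (∑ i, z i • φ i, ∑ i, z i • (lam i : ℂ) • φ i) ∈ T ∧
      (⟪∑ i, z i • φ i, ∑ i, z i • (lam i : ℂ) • φ i⟫_ℂ).re ≤
        lam N * ‖∑ i, z i • φ i‖ ^ 2 := by
  have hker : LinearMap.ker l ≠ ⊥ := LinearMap.ker_ne_bot_of_finrank_lt (by
    rw [finrank_fintype_fun_eq_card, Fintype.card_fin]; omega)
  obtain ⟨z, hz, hz0⟩ := Submodule.exists_mem_ne_zero_of_ne_bot hker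
  have hφ' : Orthonormal ℂ (fun i : Fin (N + 1) => φ i) := hφ.comp _ Fin.val_injective
  refine ⟨z, hz, fun h0 => hz0 ?_, ?_, ?_⟩
  · ext i
    exact Fintype.linearIndependent_iff.1 hφ'.linearIndependent z h0 i
  · have : (∑ i, z i • φ i, ∑ i, z i • (lam i : ℂ) • φ i) =
        ∑ i : Fin (N + 1), z i • ((φ i, (lam i : ℂ) • φ i) : X × X) := by
      rw [Prod.ext_iff, Prod.fst_sum, Prod.snd_sum]
      exact ⟨rfl, rfl⟩
    rw [this]
    exact T.sum_mem fun i _ => T.smul_mem _ (hT i)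
  · have e1 : ⟪∑ i, z i • φ i, ∑ i, z i • (lam i : ℂ) • φ i⟫_ℂ =
        ∑ i : Fin (N + 1), ((lam i * ‖z i‖ ^ 2 : ℝ) : ℂ) := by
      simp only [smul_smul]
      rw [hφ'.inner_sum]
      refine Finset.sum_congr rfl fun i _ => ?_
      rw [← mul_assoc, mul_comm (conj _), Complex.mul_conj, Complex.normSq_eq_norm_sq]
      push_cast
      ring
    have e2 : ‖∑ i : Fin (N + 1), z i • φ i‖ ^ 2 = ∑ i : Fin (N + 1), ‖z i‖ ^ 2 := by
      have := hφ'.inner_sum z z Finset.univ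
      rw [inner_self_eq_norm_sq_to_K] at this
      have h2 : ∀ i, conj (z i) * z i = ((‖z i‖ ^ 2 : ℝ) : ℂ) := fun i => by
        rw [mul_comm, Complex.mul_conj, Complex.normSq_eq_norm_sq]
      simp only [h2] at this
      change ((‖_‖ : ℝ) : ℂ) ^ 2 = _ at this
      exact_mod_cast this
    rw [e1, e2, ← Complex.ofReal_sum, Complex.ofReal_re, Finset.mul_sum]
    exact Finset.sum_le_sum fun i _ =>
      mul_le_mul_of_nonneg_right (hlam (by omega)) (sq_nonneg _)

end LinearRelation

/-! ### The quadratic form on a graph, Green's formula and semiboundedness. -/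

namespace QuantumGraph

open scoped InnerProductSpace ComplexConjugate
open Module Filter Topology

variable {V E : Type*} [DecidableEq V] [Fintype E] (Γ : QuantumGraph V E)

instance isFiniteMeasure_edgeMeasure (e : E) : IsFiniteMeasure (Γ.edgeMeasure e) := by
  unfold MetricGraph.edgeMeasure
  infer_instance

theorem edgeMeasure_eq (e : E) : Γ.edgeMeasure e = volume.restrict (Icc 0 (Γ.length e)) := rfl

theorem integral_edgeMeasure (e : E) (f : ℝ → ℂ) :
    ∫ x, f x ∂Γ.edgeMeasure e = ∫ x in (0 : ℝ)..Γ.length e, f x := by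
  rw [edgeMeasure_eq, integral_Icc_eq_integral_Ioc,
    intervalIntegral.integral_of_le (Γ.length_pos e).le]

theorem inner_edge {e : E} {f g : Lp ℂ 2 (Γ.edgeMeasure e)} {u w : ℝ → ℂ}
    (hf : f =ᵐ[Γ.edgeMeasure e] u) (hg : g =ᵐ[Γ.edgeMeasure e] w) :
    ⟪f, g⟫_ℂ = ∫ x in (0 : ℝ)..Γ.length e, conj (u x) * w x := by
  rw [L2.inner_def, ← integral_edgeMeasure]
  refine integral_congr_ae ?_
  filter_upwards [hf, hg] with x h1 h2
  rw [h1, h2, RCLike.inner_apply, mul_comm]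

theorem norm_sq_edge {e : E} {f : Lp ℂ 2 (Γ.edgeMeasure e)} {u : ℝ → ℂ}
    (hf : f =ᵐ[Γ.edgeMeasure e] u) :
    ‖f‖ ^ 2 = ∫ x in Icc 0 (Γ.length e), ‖u x‖ ^ 2 := by
  have h1 : ⟪f, f⟫_ℂ = ∫ x, ((‖u x‖ ^ 2 : ℝ) : ℂ) ∂Γ.edgeMeasure e := by
    rw [L2.inner_def]
    refine integral_congr_ae ?_
    filter_upwards [hf] with x h1
    rw [h1, inner_self_eq_norm_sq_to_K]
    norm_cast
  rw [inner_self_eq_norm_sq_to_K, integral_complex_ofReal] at h1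
  change ((‖f‖ : ℝ) : ℂ) ^ 2 = _ at h1
  exact_mod_cast h1

theorem _root_.MetricGraph.HasH1Deriv.continuousOn {e : E} {u u' : ℝ → ℂ}
    (h : Γ.HasH1Deriv e u u') : ContinuousOn u (Icc 0 (Γ.length e)) := by
  have hL := Γ.length_pos e
  have hint := Γ.intervalIntegrable_of_memLp h.1 (x := Γ.length e) ⟨hL.le, le_rfl⟩
  have h0 := intervalIntegral.continuousOn_primitive_interval' hint left_mem_uIcc
  rw [uIcc_of_le hL.le] at h0
  exact (continuousOn_const.add h0).congr h.2

theorem memLp_of_continuousOn {e : E} {u : ℝ → ℂ} (h : ContinuousOn u (Icc 0 (Γ.length e)))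
    (p : ENNReal) : MemLp u p (Γ.edgeMeasure e) := by
  obtain ⟨C, hC⟩ := isCompact_Icc.exists_bound_of_continuousOn h
  refine MemLp.of_bound (h.aestronglyMeasurable measurableSet_Icc) C ?_
  rw [edgeMeasure_eq, ae_restrict_iff' measurableSet_Icc]
  exact Eventually.of_forall hC

theorem memLp_potential_mul {e : E} {u : ℝ → ℂ} (h : ContinuousOn u (Icc 0 (Γ.length e))) :
    MemLp (fun x => (Γ.potential e x : ℂ) * u x) 2 (Γ.edgeMeasure e) :=
  (Γ.memLp_of_continuousOn h ⊤).mul (Γ.potential_memLp e).ofReal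

/-- A function in `H¹` of each edge, its derivative, its product with the potential, and its values
at the edge ends. -/
abbrev H1Space : Type _ :=
  Γ.L2Space × Γ.L2Space × Γ.L2Space × EuclideanSpace ℂ (E × Bool)

/-- `w` is formed from the functions `u` on the edges with derivatives `u'`. -/
structure IsH1Data (w : Γ.H1Space) (u u' : E → ℝ → ℂ) : Prop where
  ae_eq : ∀ e, w.1 e =ᵐ[Γ.edgeMeasure e] u e
  hasH1Deriv : ∀ e, Γ.HasH1Deriv e (u e) (u' e)
  deriv_ae_eq : ∀ e, w.2.1 e =ᵐ[Γ.edgeMeasure e] u' e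
  potential_ae_eq : ∀ e, w.2.2.1 e =ᵐ[Γ.edgeMeasure e] fun x => Γ.potential e x * u e x
  boundary_eq : w.2.2.2 = WithLp.toLp 2 (Γ.boundaryValue u)

variable {Γ}

theorem IsH1Data.add {w₁ w₂ : Γ.H1Space} {u₁ u₁' u₂ u₂' : E → ℝ → ℂ} (h : Γ.IsH1Data w₁ u₁ u₁')
    (k : Γ.IsH1Data w₂ u₂ u₂') : Γ.IsH1Data (w₁ + w₂) (u₁ + u₂) (u₁' + u₂') where
  ae_eq e := (Lp.coeFn_add (w₁.1 e) (w₂.1 e)).trans ((h.ae_eq e).add (k.ae_eq e))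
  hasH1Deriv e := HasH1Deriv.add Γ (h.hasH1Deriv e) (k.hasH1Deriv e)
  deriv_ae_eq e :=
    (Lp.coeFn_add (w₁.2.1 e) (w₂.2.1 e)).trans ((h.deriv_ae_eq e).add (k.deriv_ae_eq e))
  potential_ae_eq e := by
    refine (Lp.coeFn_add (w₁.2.2.1 e) (w₂.2.2.1 e)).trans
      (((h.potential_ae_eq e).add (k.potential_ae_eq e)).trans (Eventually.of_forall fun x => ?_))
    simp only [Pi.add_apply]
    ring
  boundary_eq := by
    rw [boundaryValue_add, WithLp.toLp_add, ← h.boundary_eq, ← k.boundary_eq]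
    rfl

theorem IsH1Data.smul (c : ℂ) {w : Γ.H1Space} {u u' : E → ℝ → ℂ} (h : Γ.IsH1Data w u u') :
    Γ.IsH1Data (c • w) (c • u) (c • u') where
  ae_eq e := (Lp.coeFn_smul c (w.1 e)).trans ((h.ae_eq e).const_smul c)
  hasH1Deriv e := HasH1Deriv.smul Γ c (h.hasH1Deriv e)
  deriv_ae_eq e := (Lp.coeFn_smul c (w.2.1 e)).trans ((h.deriv_ae_eq e).const_smul c)
  potential_ae_eq e := by
    refine (Lp.coeFn_smul c (w.2.2.1 e)).trans
      (((h.potential_ae_eq e).const_smul c).trans (Eventually.of_forall fun x => ?_))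
    simp only [Pi.smul_apply, smul_eq_mul]
    ring
  boundary_eq := by
    rw [boundaryValue_smul, WithLp.toLp_smul, ← h.boundary_eq]
    rfl

theorem exists_isH1Data {u u' : E → ℝ → ℂ} (h : ∀ e, Γ.HasH1Deriv e (u e) (u' e)) :
    ∃ w, Γ.IsH1Data w u u' :=
  ⟨(WithLp.toLp 2 fun e => (Γ.memLp_of_continuousOn (h e).continuousOn 2).toLp,
    WithLp.toLp 2 fun e => (h e).1.toLp,
    WithLp.toLp 2 fun e => (Γ.memLp_potential_mul (h e).continuousOn).toLp, _),
    fun e => (Γ.memLp_of_continuousOn (h e).continuousOn 2).coeFn_toLp, h,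
    fun e => (h e).1.coeFn_toLp,
    fun e => (Γ.memLp_potential_mul (h e).continuousOn).coeFn_toLp, rfl⟩

variable (Γ)

/-- The quadratic form of `-d²/dx² + V` with boundary term given by `S`. -/
noncomputable def energyForm
    (S : EuclideanSpace ℂ (E × Bool) →ₗ[ℂ] EuclideanSpace ℂ (E × Bool)) :
    Γ.H1Space →ₗ⋆[ℂ] Γ.H1Space →ₗ[ℂ] ℂ :=
  LinearMap.mk₂'ₛₗ (starRingEnd ℂ) (RingHom.id ℂ)
    (fun v w => ⟪v.2.1, w.2.1⟫_ℂ + ⟪v.2.2.1, w.1⟫_ℂ + ⟪S v.2.2.2, w.2.2.2⟫_ℂ)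
    (fun v₁ v₂ w => by
      simp only [Prod.fst_add, Prod.snd_add, inner_add_left, map_add]; ring)
    (fun c v w => by
      simp only [Prod.smul_fst, Prod.smul_snd, inner_smul_left, map_smul, smul_eq_mul]; ring)
    (fun v w₁ w₂ => by
      simp only [Prod.fst_add, Prod.snd_add, inner_add_right]; ring)
    (fun c v w => by
      simp only [Prod.smul_fst, Prod.smul_snd, inner_smul_right, smul_eq_mul, RingHom.id_apply]
      ring)

theorem energyForm_apply (S : EuclideanSpace ℂ (E × Bool) →ₗ[ℂ] EuclideanSpace ℂ (E × Bool))
    (v w : Γ.H1Space) : Γ.energyForm S v w =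
      ⟪v.2.1, w.2.1⟫_ℂ + ⟪v.2.2.1, w.1⟫_ℂ + ⟪S v.2.2.2, w.2.2.2⟫_ℂ := rfl

variable {Γ}

theorem IsH1Data.inner_potential {v w : Γ.H1Space} {u u' y y' : E → ℝ → ℂ}
    (hv : Γ.IsH1Data v u u') (hw : Γ.IsH1Data w y y') :
    ⟪v.2.2.1, w.1⟫_ℂ = ⟪v.1, w.2.2.1⟫_ℂ := by
  rw [PiLp.inner_apply, PiLp.inner_apply]
  refine Finset.sum_congr rfl fun e _ => ?_
  rw [Γ.inner_edge (hv.potential_ae_eq e) (hw.ae_eq e),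
    Γ.inner_edge (hv.ae_eq e) (hw.potential_ae_eq e)]
  congr 1
  ext x
  rw [map_mul, Complex.conj_ofReal]
  ring

theorem energyForm_conj {S : EuclideanSpace ℂ (E × Bool) →ₗ[ℂ] EuclideanSpace ℂ (E × Bool)}
    (hS : S.IsSymmetric) {v w : Γ.H1Space} {u u' y y' : E → ℝ → ℂ}
    (hv : Γ.IsH1Data v u u') (hw : Γ.IsH1Data w y y') :
    conj (Γ.energyForm S v w) = Γ.energyForm S w v := by
  rw [energyForm_apply, energyForm_apply, map_add, map_add, inner_conj_symm, inner_conj_symm,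
    inner_conj_symm, hw.inner_potential hv, hS]

/-- Green's formula. -/
theorem IsH1Data.green {v w : Γ.H1Space} {u u' u'' y y' : E → ℝ → ℂ} {g : Γ.L2Space}
    (hv : Γ.IsH1Data v u u') (hu' : ∀ e, Γ.HasH1Deriv e (u' e) (u'' e))
    (hg : ∀ e, g e =ᵐ[Γ.edgeMeasure e] fun x => - u'' e x + Γ.potential e x * u e x)
    (hw : Γ.IsH1Data w y y') :
    ⟪g, w.1⟫_ℂ = ⟪v.2.1, w.2.1⟫_ℂ + ⟪v.2.2.1, w.1⟫_ℂ +
      ⟪(WithLp.toLp 2 (Γ.boundaryDeriv u') : EuclideanSpace ℂ (E × Bool)), w.2.2.2⟫_ℂ := by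
  rw [PiLp.inner_apply, PiLp.inner_apply, PiLp.inner_apply, PiLp.inner_apply,
    Fintype.sum_prod_type, ← Finset.sum_add_distrib, ← Finset.sum_add_distrib]
  refine Finset.sum_congr rfl fun e _ => ?_
  have hL := Γ.length_pos e
  have hLm : Γ.length e ∈ Icc 0 (Γ.length e) := ⟨hL.le, le_rfl⟩
  have hyc := (hw.hasH1Deriv e).continuousOn
  have huc := (hu' e).continuousOn
  rw [← uIcc_of_le hL.le] at hyc huc
  have i0 := Γ.intervalIntegrable_of_memLp (hu' e).1.star hLm
  have i1 := i0.mul_continuousOn hyc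
  have i2 := (Γ.intervalIntegrable_of_memLp (hw.hasH1Deriv e).1 hLm).continuousOn_mul
    (Complex.continuous_conj.comp_continuousOn huc)
  have i3 := (Γ.intervalIntegrable_of_memLp
    (Γ.memLp_potential_mul (hv.hasH1Deriv e).continuousOn).star hLm).mul_continuousOn hyc
  have hstar : ∀ x ∈ Icc 0 (Γ.length e),
      conj (u' e x) = conj (u' e 0) + ∫ t in (0 : ℝ)..x, conj (u'' e t) := fun x hx => by
    rw [(hu' e).2 x hx, map_add]
    congr 1
    exact (Complex.conjCLE.toContinuousLinearMap.intervalIntegral_comp_comm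
      (Γ.intervalIntegrable_of_memLp (hu' e).1 hx)).symm
  have hparts := integral_mul_add_mul_of_primitive hL.le i0
    (Γ.intervalIntegrable_of_memLp (hw.hasH1Deriv e).1 hLm) hstar (hw.hasH1Deriv e).2
  rw [Γ.inner_edge (hg e) (hw.ae_eq e), Γ.inner_edge (hv.deriv_ae_eq e) (hw.deriv_ae_eq e),
    Γ.inner_edge (hv.potential_ae_eq e) (hw.ae_eq e)]
  have hsplit : ∫ x in (0 : ℝ)..Γ.length e, conj (-u'' e x + Γ.potential e x * u e x) * y e x =
      -(∫ x in (0 : ℝ)..Γ.length e, conj (u'' e x) * y e x) +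
      ∫ x in (0 : ℝ)..Γ.length e, conj (Γ.potential e x * u e x) * y e x := by
    rw [← intervalIntegral.integral_neg, ← intervalIntegral.integral_add]
    · congr 1
      ext x
      rw [map_add, map_neg]
      ring
    · exact i1.neg
    · exact i3
  have hparts' : (∫ x in (0 : ℝ)..Γ.length e, conj (u'' e x) * y e x) +
      ∫ x in (0 : ℝ)..Γ.length e, conj (u' e x) * y' e x =
      conj (u' e (Γ.length e)) * y e (Γ.length e) - conj (u' e 0) * y e 0 := by
    rw [← hparts, ← intervalIntegral.integral_add]
    · rfl
    · exact i1
    · exact i2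
  rw [hsplit, hw.boundary_eq]
  simp only [Fintype.sum_bool, RCLike.inner_apply, MetricGraph.boundaryDeriv,
    MetricGraph.boundaryValue, map_neg]
  linear_combination -hparts'

theorem IsH1Data.norm_sq_le {w : Γ.H1Space} {u u' : E → ℝ → ℂ} (hw : Γ.IsH1Data w u u')
    {e : E} {δ : ℝ} (hδ : 0 < δ) (hδL : δ ≤ Γ.length e) {x : ℝ} (hx : x ∈ Icc 0 (Γ.length e)) :
    ‖u e x‖ ^ 2 ≤ 2 / δ * ‖w.1‖ ^ 2 + 2 * δ * ‖w.2.1‖ ^ 2 := by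
  have h1 := norm_sq_le_of_primitive hδ hδL (hw.hasH1Deriv e).1
    (Γ.memLp_of_continuousOn (hw.hasH1Deriv e).continuousOn 2) (hw.hasH1Deriv e).2 hx
  rw [← Γ.norm_sq_edge (hw.ae_eq e), ← Γ.norm_sq_edge (hw.deriv_ae_eq e)] at h1
  refine h1.trans ?_
  gcongr
  · exact PiLp.norm_apply_le w.1 e
  · exact PiLp.norm_apply_le w.2.1 e

variable (Γ)

/-- Boundedness below of the form, with control of the derivative. -/
theorem exists_le_energyForm
    (S : EuclideanSpace ℂ (E × Bool) →ₗ[ℂ] EuclideanSpace ℂ (E × Bool)) :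
    ∃ C : ℝ, ∀ (w : Γ.H1Space) (u u' : E → ℝ → ℂ), Γ.IsH1Data w u u' →
      ‖w.2.1‖ ^ 2 / 2 - C * ‖w.1‖ ^ 2 ≤ (Γ.energyForm S w w).re := by
  set S' := LinearMap.toContinuousLinearMap S with hS'
  set v : ℝ := ∑ e, ∫ x in Icc 0 (Γ.length e), ‖Γ.potential e x‖ ^ 2 with hv
  have hv0 : 0 ≤ v := Finset.sum_nonneg fun e _ => integral_nonneg fun x => sq_nonneg _
  -- `K` is the total coefficient of the sup bound `M` in the potential and boundary terms. With `2
  -- K δ ≤ 1 / 2` their derivative part takes at most half of `‖u'‖²`.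
  set K : ℝ := v / 2 + ‖S'‖ * Fintype.card (E × Bool) with hK
  have hK0 : 0 ≤ K := by positivity
  obtain ⟨δ, hδ, hδL, hδK⟩ : ∃ δ : ℝ, 0 < δ ∧ (∀ e, δ ≤ Γ.length e) ∧ K * (2 * δ) ≤ 1 / 2 := by
    have h1 : 0 < 1 / (4 * (K + 1)) := by positivity
    obtain ⟨m, hm, hmL⟩ : ∃ m : ℝ, 0 < m ∧ ∀ e, m ≤ Γ.length e := by
      rcases isEmpty_or_nonempty E with hE | hE
      · exact ⟨1, one_pos, fun e => isEmptyElim e⟩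
      · obtain ⟨e₀, he₀⟩ := Finite.exists_min Γ.length
        exact ⟨_, Γ.length_pos e₀, he₀⟩
    refine ⟨min m (1 / (4 * (K + 1))), lt_min hm h1, fun e => (min_le_left _ _).trans (hmL e), ?_⟩
    calc K * (2 * min m (1 / (4 * (K + 1)))) ≤ K * (2 * (1 / (4 * (K + 1)))) := by
          gcongr
          exact min_le_right _ _
      _ = K / (K + 1) * (1 / 2) := by field_simp; ring
      _ ≤ 1 * (1 / 2) := by
          gcongr
          rw [div_le_one (by positivity)]
          linarith
      _ = 1 / 2 := one_mul _
  refine ⟨K * (2 / δ) + 1 / 2, fun w u u' hw => ?_⟩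
  set M : ℝ := 2 / δ * ‖w.1‖ ^ 2 + 2 * δ * ‖w.2.1‖ ^ 2 with hM
  have hM0 : 0 ≤ M := by positivity
  have hsup : ∀ e, ∀ x ∈ Icc 0 (Γ.length e), ‖u e x‖ ^ 2 ≤ M := fun e x hx =>
    hw.norm_sq_le hδ (hδL e) hx
  have hp : ‖w.2.2.1‖ ^ 2 ≤ v * M := by
    rw [PiLp.norm_sq_eq_of_L2, hv, Finset.sum_mul]
    refine Finset.sum_le_sum fun e _ => ?_
    rw [Γ.norm_sq_edge (hw.potential_ae_eq e), ← integral_mul_const]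
    refine setIntegral_mono_on ?_ ?_ measurableSet_Icc fun x hx => ?_
    · exact (Γ.memLp_potential_mul (hw.hasH1Deriv e).continuousOn).integrable_norm_pow
        (by norm_num)
    · exact ((Γ.potential_memLp e).integrable_norm_pow (by norm_num)).mul_const _
    · rw [norm_mul, mul_pow, Complex.norm_real]
      exact mul_le_mul_of_nonneg_left (hsup e x hx) (sq_nonneg _)
  have hF : ‖w.2.2.2‖ ^ 2 ≤ Fintype.card (E × Bool) * M := by
    rw [PiLp.norm_sq_eq_of_L2, ← nsmul_eq_mul, ← Finset.card_univ]
    refine Finset.sum_le_card_nsmul _ _ _ fun b _ => ?_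
    rw [hw.boundary_eq]
    obtain ⟨e, _ | _⟩ := b
    · exact hsup e 0 ⟨le_rfl, (Γ.length_pos e).le⟩
    · exact hsup e _ ⟨(Γ.length_pos e).le, le_rfl⟩
  have h1 : -(‖w.2.2.1‖ * ‖w.1‖) ≤ (⟪w.2.2.1, w.1⟫_ℂ).re := by
    have := (Complex.abs_re_le_norm _).trans (norm_inner_le_norm (𝕜 := ℂ) w.2.2.1 w.1)
    exact (abs_le.1 this).1
  have h2 : -(‖S'‖ * ‖w.2.2.2‖ ^ 2) ≤ (⟪S w.2.2.2, w.2.2.2⟫_ℂ).re := by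
    have h3 := (Complex.abs_re_le_norm _).trans
      (norm_inner_le_norm (𝕜 := ℂ) (S w.2.2.2) w.2.2.2)
    have h4 : ‖S w.2.2.2‖ ≤ ‖S'‖ * ‖w.2.2.2‖ := S'.le_opNorm w.2.2.2
    have h5 := (abs_le.1 h3).1
    nlinarith [norm_nonneg w.2.2.2]
  have h3 : (⟪w.2.1, w.2.1⟫_ℂ).re = ‖w.2.1‖ ^ 2 := by
    rw [inner_self_eq_norm_sq_to_K]
    norm_cast
  rw [energyForm_apply, Complex.add_re, Complex.add_re, h3]
  have h4 : ‖w.2.2.1‖ * ‖w.1‖ ≤ v * M / 2 + ‖w.1‖ ^ 2 / 2 := by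
    nlinarith [sq_nonneg (‖w.2.2.1‖ - ‖w.1‖)]
  have h5 : ‖S'‖ * ‖w.2.2.2‖ ^ 2 ≤ ‖S'‖ * (Fintype.card (E × Bool) * M) := by gcongr
  have h6 : K * M = K * (2 / δ) * ‖w.1‖ ^ 2 + K * (2 * δ) * ‖w.2.1‖ ^ 2 := by rw [hM]; ring
  have h7 : K * (2 * δ) * ‖w.2.1‖ ^ 2 ≤ 1 / 2 * ‖w.2.1‖ ^ 2 := by gcongr
  have h8 : K * M = v * M / 2 + ‖S'‖ * (Fintype.card (E × Bool) * M) := by rw [hK]; ring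
  linarith

end QuantumGraph

theorem MeasureTheory.Lp.coeFn_sum_smul {α ι : Type*} {m : MeasurableSpace α} {μ : Measure α}
    {p : ENNReal} (s : Finset ι) (c : ι → ℂ) (f : ι → Lp ℂ p μ) :
    (∑ j ∈ s, c j • f j : Lp ℂ p μ) =ᵐ[μ] fun x => ∑ j ∈ s, c j * f j x := by
  classical
  induction s using Finset.induction_on with
  | empty => exact Lp.coeFn_zero ℂ p μ
  | insert i s hi ih =>
    rw [Finset.sum_insert hi]
    filter_upwards [Lp.coeFn_add (c i • f i) (∑ j ∈ s, c j • f j), Lp.coeFn_smul (c i) (f i), ih]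
      with x h1 h2 h3
    rw [h1, Pi.add_apply, h2, h3, Finset.sum_insert hi, Pi.smul_apply, smul_eq_mul]

/-! ### Solvability of `(H + γ) f = g`, Rellich's theorem and the compact resolvent. -/

namespace QuantumGraph

open scoped InnerProductSpace ComplexConjugate
open Module Filter Topology

variable {V E : Type*} [DecidableEq V] [Fintype E] (Γ : QuantumGraph V E)

theorem exists_edge_solution (γ : ℝ) (e : E) {r : ℝ → ℂ} (hr : MemLp r 2 (Γ.edgeMeasure e))
    (a b : ℂ) : ∃ u u' : ℝ → ℂ, Γ.HasH1Deriv e u u' ∧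
      Γ.HasH1Deriv e u' (fun x => Γ.potential e x * u x + γ * u x + r x) ∧ u 0 = a ∧ u' 0 = b := by
  have hL := Γ.length_pos e
  -- Coefficients are cut off outside the edge, to be integrable on the whole line.
  have hint : ∀ {f : ℝ → ℂ}, MemLp f 2 (Γ.edgeMeasure e) →
      Integrable ((Icc 0 (Γ.length e)).indicator f) := fun {f} hf => by
    rw [integrable_indicator_iff measurableSet_Icc]
    exact hf.integrable (by norm_num)
  have hV : MemLp (fun x => (Γ.potential e x : ℂ)) 2 (Γ.edgeMeasure e) :=
    (Γ.potential_memLp e).ofReal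
  have hq1 := hint (hV.add (memLp_const (γ : ℂ)))
  have hr1 := hint hr
  obtain ⟨u, u', huc, huc', hu, hu'⟩ := exists_solution_of_integrable hL.le hq1 hr1 a b
  have hu0 : u 0 = a := by simpa using hu 0
  have hu0' : u' 0 = b := by simpa using hu' 0 ⟨le_rfl, hL.le⟩
  refine ⟨u, u', ⟨Γ.memLp_of_continuousOn huc'.continuousOn 2, fun x _ => ?_⟩,
    ⟨?_, fun x hx => ?_⟩, hu0, hu0'⟩
  · rw [hu0]; exact hu x
  · have h1 := Γ.memLp_potential_mul (e := e) huc.continuousOn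
    have h2 := (Γ.memLp_of_continuousOn (e := e) huc.continuousOn 2).const_mul (γ : ℂ)
    exact (h1.add h2).add hr
  · rw [hu0', hu' x hx]
    congr 1
    refine intervalIntegral.integral_congr fun t ht => ?_
    rw [uIcc_of_le hx.1] at ht
    have ht' : t ∈ Icc 0 (Γ.length e) := ⟨ht.1, ht.2.trans hx.2⟩
    simp only [indicator_of_mem ht', Pi.add_apply]
    ring

/-- The left-hand sides of all the vertex conditions. -/
def boundaryMap : ((E → ℝ → ℂ) × (E → ℝ → ℂ)) →ₗ[ℂ] ((v : V) → Γ.BondsAt v → ℂ) where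
  toFun p v := (Γ.A v).mulVec (fun b => Γ.boundaryValue p.1 b.1) +
    (Γ.B v).mulVec (fun b => Γ.boundaryDeriv p.2 b.1)
  map_add' p q := by
    funext v
    rw [Prod.fst_add, Prod.snd_add, boundaryValue_add, boundaryDeriv_add]
    change (Γ.A v).mulVec ((fun b => Γ.boundaryValue p.1 b.1) +
      (fun b => Γ.boundaryValue q.1 b.1)) + (Γ.B v).mulVec
      ((fun b => Γ.boundaryDeriv p.2 b.1) + (fun b => Γ.boundaryDeriv q.2 b.1)) = _
    rw [Matrix.mulVec_add, Matrix.mulVec_add, add_add_add_comm]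
    rfl
  map_smul' c p := by
    funext v
    rw [Prod.smul_fst, Prod.smul_snd, boundaryValue_smul, boundaryDeriv_smul]
    change (Γ.A v).mulVec (c • (fun b => Γ.boundaryValue p.1 b.1)) +
      (Γ.B v).mulVec (c • (fun b => Γ.boundaryDeriv p.2 b.1)) = _
    rw [Matrix.mulVec_smul, Matrix.mulVec_smul, ← smul_add]
    rfl

/-- On each edge the solutions form a two-parameter affine family, and the vertex conditions number
the sum of the degrees, which is `2 |E|`. The linear system for the parameters is square, so
uniqueness implies existence. -/
theorem exists_hamiltonianRel_of_injective [Fintype V] (γ : ℝ)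
    (hinj : ∀ f, Γ.HamiltonianRel f (-((γ : ℂ) • f)) → f = 0) (g : Γ.L2Space) :
    ∃ f, Γ.HamiltonianRel f (g - (γ : ℂ) • f) := by
  have hrel : ∀ (r : E → ℝ → ℂ) (k : Γ.L2Space) (u u' : E → ℝ → ℂ),
      (∀ e, k e =ᵐ[Γ.edgeMeasure e] fun x => -r e x) →
      (∀ e, Γ.HasH1Deriv e (u e) (u' e)) →
      (∀ e, Γ.HasH1Deriv e (u' e) (fun x => Γ.potential e x * u e x + γ * u e x + r e x)) →
      Γ.boundaryMap (u, u') = 0 → ∃ f : Γ.L2Space, (∀ e, f e =ᵐ[Γ.edgeMeasure e] u e) ∧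
        Γ.HamiltonianRel f (k - (γ : ℂ) • f) := by
    intro r k u u' hk h1 h2 h3
    obtain ⟨w, hw⟩ := exists_isH1Data h1
    refine ⟨w.1, hw.ae_eq, u, u', _, hw.ae_eq, h1, h2, fun v => congrFun h3 v, fun e => ?_⟩
    filter_upwards [Lp.coeFn_sub (k e) ((γ : ℂ) • w.1 e), Lp.coeFn_smul (γ : ℂ) (w.1 e),
      hk e, hw.ae_eq e] with x k1 k2 k3 k4
    refine k1.trans ?_
    rw [Pi.sub_apply, k2, k3, Pi.smul_apply, k4, smul_eq_mul]
    ring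
  -- The equation is `u'' = V u + γ u + r` with `r = -g`. `P` is a particular solution; `C` and `D`
  -- below are the homogeneous ones with initial data `(1, 0)` and `(0, 1)`.
  choose P P' hP hP' hP0 hP0' using fun e =>
    Γ.exists_edge_solution γ e (Lp.memLp (-g e)) 0 0
  choose C C' hC hC' hC0 hC0' using fun e =>
    Γ.exists_edge_solution γ e (MemLp.zero' : MemLp (fun _ => (0 : ℂ)) 2 (Γ.edgeMeasure e)) 1 0
  choose D D' hD hD' hD0 hD0' using fun e =>
    Γ.exists_edge_solution γ e (MemLp.zero' : MemLp (fun _ => (0 : ℂ)) 2 (Γ.edgeMeasure e)) 0 1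
  let sol : (E × Bool → ℂ) →ₗ[ℂ] ((E → ℝ → ℂ) × (E → ℝ → ℂ)) :=
    { toFun := fun z => (fun e => z (e, false) • C e + z (e, true) • D e,
        fun e => z (e, false) • C' e + z (e, true) • D' e)
      map_add' := fun y z => by
        ext e x <;> simp <;> ring
      map_smul' := fun c z => by
        ext e x <;> simp <;> ring }
  have hsol1 : ∀ z e, Γ.HasH1Deriv e ((sol z).1 e) ((sol z).2 e) := fun z e =>
    HasH1Deriv.add Γ (HasH1Deriv.smul Γ _ (hC e)) (HasH1Deriv.smul Γ _ (hD e))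
  have hsol2 : ∀ z e, Γ.HasH1Deriv e ((sol z).2 e)
      (fun x => Γ.potential e x * (sol z).1 e x + γ * (sol z).1 e x) := fun z e => by
    have h1 := HasH1Deriv.add Γ (HasH1Deriv.smul Γ (z (e, false)) (hC' e))
      (HasH1Deriv.smul Γ (z (e, true)) (hD' e))
    refine (congrArg (Γ.HasH1Deriv e _) (funext fun x => ?_)).mp h1
    simp only [sol, LinearMap.coe_mk, AddHom.coe_mk, Pi.add_apply, Pi.smul_apply, smul_eq_mul]
    ring
  have hker : Function.Injective (Γ.boundaryMap ∘ₗ sol) := by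
    rw [← LinearMap.ker_eq_bot, eq_bot_iff]
    intro z hz
    obtain ⟨f, hf, hfrel⟩ := hrel (fun _ _ => 0) 0 (sol z).1 (sol z).2
      (fun e => by
        simp only [neg_zero]
        exact Lp.coeFn_zero ℂ 2 (Γ.edgeMeasure e))
      (hsol1 z) (fun e => by simpa only [add_zero] using hsol2 z e) hz
    rw [zero_sub] at hfrel
    have hf0 := hinj f hfrel
    have hz1 : ∀ e, (∀ x ∈ Icc 0 (Γ.length e), (sol z).1 e x = 0) ∧
        ∀ x ∈ Icc 0 (Γ.length e), (sol z).2 e x = 0 := fun e => by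
      have h1 : (sol z).1 e =ᵐ[Γ.edgeMeasure e] 0 := by
        refine (hf e).symm.trans ?_
        rw [hf0]
        exact Lp.coeFn_zero ℂ 2 (Γ.edgeMeasure e)
      obtain ⟨h2, h3⟩ := HasH1Deriv.ae_eq_zero Γ (hsol1 z e) h1
      exact ⟨h2, (HasH1Deriv.ae_eq_zero Γ (hsol2 z e) h3).1⟩
    have h0 : ∀ e, (0 : ℝ) ∈ Icc 0 (Γ.length e) := fun e => ⟨le_rfl, (Γ.length_pos e).le⟩
    change z = 0
    ext ⟨e, b⟩
    cases b
    · simpa [sol, hC0, hD0] using (hz1 e).1 0 (h0 e)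
    · simpa [sol, hC0', hD0'] using (hz1 e).2 0 (h0 e)
  have hdim : finrank ℂ (E × Bool → ℂ) = finrank ℂ ((v : V) → Γ.BondsAt v → ℂ) := by
    rw [finrank_fintype_fun_eq_card, finrank_pi_fintype]
    simp only [finrank_fintype_fun_eq_card]
    rw [← Fintype.card_sigma, Fintype.card_congr (Equiv.sigmaFiberEquiv Γ.origin)]
  obtain ⟨z, hz⟩ := (LinearMap.injective_iff_surjective_of_finrank_eq_finrank hdim).1 hker
    (-Γ.boundaryMap (P, P'))
  obtain ⟨f, -, hf⟩ := hrel (fun e => (-g e : Lp ℂ 2 (Γ.edgeMeasure e))) g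
    (P + (sol z).1) (P' + (sol z).2)
    (fun e => by
      filter_upwards [Lp.coeFn_neg (g e)] with x hx
      rw [hx, Pi.neg_apply, neg_neg])
    (fun e => HasH1Deriv.add Γ (hP e) (hsol1 z e))
    (fun e => by
      refine (congrArg (Γ.HasH1Deriv e _) (funext fun x => ?_)).mp
        (HasH1Deriv.add Γ (hP' e) (hsol2 z e))
      simp only [Pi.add_apply]
      ring)
    (by
      have : (P + (sol z).1, P' + (sol z).2) = (P, P') + sol z := rfl
      rw [this, map_add]
      change _ + (Γ.boundaryMap ∘ₗ sol) z = 0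
      rw [hz, add_neg_cancel])
  exact ⟨f, hf⟩

variable {Γ}

/-- The weak form of `H f = g`, with the outgoing derivatives as `F'`. The test function need not
satisfy any vertex condition. -/
theorem HamiltonianRel.exists_isH1Data {f g : Γ.L2Space} (h : Γ.HamiltonianRel f g) :
    ∃ (w : Γ.H1Space) (u u' : E → ℝ → ℂ) (F' : EuclideanSpace ℂ (E × Bool)),
      Γ.IsH1Data w u u' ∧ w.1 = f ∧ (w.2.2.2, F') ∈ Γ.boundaryRelation ∧
      ∀ (v : Γ.H1Space) (y y' : E → ℝ → ℂ), Γ.IsH1Data v y y' →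
        ⟪g, v.1⟫_ℂ = ⟪w.2.1, v.2.1⟫_ℂ + ⟪w.2.2.1, v.1⟫_ℂ + ⟪F', v.2.2.2⟫_ℂ := by
  obtain ⟨u, u', u'', hf, h1, h2, hv, hg⟩ := h
  obtain ⟨w, hw⟩ := QuantumGraph.exists_isH1Data h1
  refine ⟨w, u, u', WithLp.toLp 2 (Γ.boundaryDeriv u'), hw, ?_, ?_, fun v y y' hvy =>
    hw.green h2 hg hvy⟩
  · exact PiLp.ext fun e => Lp.ext ((hw.ae_eq e).trans (hf e).symm)
  · rw [hw.boundary_eq]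
    exact hv

variable (Γ)

/-- Rellich's theorem: bounded sets of `H¹` functions are precompact in `L²`. -/
theorem totallyBounded_isH1Data (r : ℝ) : TotallyBounded {f : Γ.L2Space |
    ∃ (w : Γ.H1Space) (u u' : E → ℝ → ℂ), Γ.IsH1Data w u u' ∧ w.1 = f ∧ ‖w.1‖ ≤ r ∧
      ‖w.2.1‖ ≤ r} := by
  rw [Metric.totallyBounded_iff]
  intro ε hε
  -- Each edge is cut into `N` pieces and the function replaced on each by its value at the left
  -- node. By Hölder continuity the squared error on an edge is at most `L · (L / N) · r²`.
  obtain ⟨N, hN0, hN⟩ : ∃ N : ℕ, 0 < N ∧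
      ∑ e, Γ.length e * (Γ.length e / N * r ^ 2) < (ε / 2) ^ 2 := by
    obtain ⟨N, hN⟩ := exists_nat_gt ((∑ e, Γ.length e ^ 2 * r ^ 2) / (ε / 2) ^ 2)
    have hpos : 0 ≤ (∑ e, Γ.length e ^ 2 * r ^ 2) / (ε / 2) ^ 2 := by positivity
    have hN0 : (0 : ℝ) < N := hpos.trans_lt hN
    refine ⟨N, by exact_mod_cast hN0, ?_⟩
    rw [div_lt_iff₀ (by positivity)] at hN
    have e1 : ∑ e, Γ.length e * (Γ.length e / N * r ^ 2) = (∑ e, Γ.length e ^ 2 * r ^ 2) / N := by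
      rw [Finset.sum_div]
      refine Finset.sum_congr rfl fun e _ => ?_
      ring
    rw [e1, div_lt_iff₀ hN0]
    linarith
  have hNr : (0 : ℝ) < N := by exact_mod_cast hN0
  -- There are `N + 1` cells because the floor takes the value `N` at the right end of the edge.
  let cell : E → Fin (N + 1) → Set ℝ := fun e j => {x | ⌊x * N / Γ.length e⌋₊ = j}
  have hcell : ∀ e j, MeasurableSet (cell e j) := fun e j => by
    have : Measurable fun x : ℝ => ⌊x * N / Γ.length e⌋₊ :=
      Nat.measurable_floor.comp ((measurable_id.mul_const _).div_const _)
    exact this (measurableSet_singleton _)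
  let ind : (e : E) → Fin (N + 1) → Lp ℂ 2 (Γ.edgeMeasure e) := fun e j =>
    indicatorConstLp 2 (hcell e j) (measure_ne_top _ _) (1 : ℂ)
  let step : (E × Fin (N + 1) → ℂ) →ₗ[ℂ] Γ.L2Space :=
    { toFun := fun a => WithLp.toLp 2 fun e => ∑ j, a (e, j) • ind e j
      map_add' := fun a b => by
        refine PiLp.ext fun e => ?_
        simp only [Pi.add_apply, add_smul, Finset.sum_add_distrib, PiLp.add_apply]
      map_smul' := fun c a => by
        refine PiLp.ext fun e => ?_
        simp only [Pi.smul_apply, smul_eq_mul, mul_smul, Finset.smul_sum, PiLp.smul_apply,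
          RingHom.id_apply] }
  have hstep : ∀ a e, ∀ᵐ x ∂Γ.edgeMeasure e, ∀ j : Fin (N + 1), x ∈ cell e j →
      (step a) e x = a (e, j) := by
    intro a e
    have h1 : (step a) e =ᵐ[Γ.edgeMeasure e]
        fun x => ∑ j, a (e, j) * (cell e j).indicator (fun _ => (1 : ℂ)) x := by
      refine (Lp.coeFn_sum_smul Finset.univ (fun j => a (e, j)) (ind e)).trans ?_
      have h2 : ∀ᵐ x ∂Γ.edgeMeasure e, ∀ j, ind e j x =
          (cell e j).indicator (fun _ => (1 : ℂ)) x := ae_all_iff.2 fun j => indicatorConstLp_coeFn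
      filter_upwards [h2] with x hx
      simp only [hx]
    filter_upwards [h1] with x hx j hj
    rw [hx, Finset.sum_eq_single j]
    · rw [indicator_of_mem hj, mul_one]
    · intro i _ hij
      rw [indicator_of_notMem, mul_zero]
      intro hi
      exact hij (Fin.ext (hi.symm.trans hj))
    · simp
  -- The nodal values are bounded by the sup estimate with `δ` the edge length and by `t ≤ t² + 1`.
  -- So the step functions lie in the linear image of a compact polydisc.
  let K : Set (E × Fin (N + 1) → ℂ) := univ.pi fun i =>
    Metric.closedBall 0 (2 / Γ.length i.1 * r ^ 2 + 2 * Γ.length i.1 * r ^ 2 + 1)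
  have hK : IsCompact K := isCompact_univ_pi fun i => isCompact_closedBall _ _
  have hKc := hK.image (LinearMap.continuous_of_finiteDimensional step)
  obtain ⟨t, ht, hcov⟩ := Metric.totallyBounded_iff.1 hKc.totallyBounded (ε / 2) (half_pos hε)
  refine ⟨t, ht, ?_⟩
  rintro f ⟨w, u, u', hw, rfl, hwr, hwr'⟩
  let node : E → ℕ → ℝ := fun e j => j * (Γ.length e / N)
  have hnode : ∀ e (j : Fin (N + 1)), node e j ∈ Icc 0 (Γ.length e) := fun e j => by
    have hL := Γ.length_pos e
    refine ⟨by positivity, ?_⟩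
    have : (j : ℝ) ≤ N := by exact_mod_cast Nat.lt_succ_iff.1 j.2
    calc (j : ℝ) * (Γ.length e / N) ≤ N * (Γ.length e / N) := by gcongr
      _ = Γ.length e := by field_simp
  let a : E × Fin (N + 1) → ℂ := fun i => u i.1 (node i.1 i.2)
  have haK : a ∈ K := by
    intro i _
    have hL := Γ.length_pos i.1
    have h1 := hw.norm_sq_le hL le_rfl (hnode i.1 i.2)
    have h2 : ‖w.1‖ ^ 2 ≤ r ^ 2 := pow_le_pow_left₀ (norm_nonneg _) hwr 2
    have h3 : ‖w.2.1‖ ^ 2 ≤ r ^ 2 := pow_le_pow_left₀ (norm_nonneg _) hwr' 2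
    rw [mem_closedBall_zero_iff]
    have h4 : 2 / Γ.length i.1 * ‖w.1‖ ^ 2 ≤ 2 / Γ.length i.1 * r ^ 2 := by gcongr
    have h5 : 2 * Γ.length i.1 * ‖w.2.1‖ ^ 2 ≤ 2 * Γ.length i.1 * r ^ 2 := by gcongr
    change ‖u i.1 (node i.1 i.2)‖ ≤ _
    nlinarith [sq_nonneg (‖u i.1 (node i.1 i.2)‖ - 1)]
  have hdist : ‖w.1 - step a‖ < ε / 2 := by
    refine lt_of_pow_lt_pow_left₀ 2 (half_pos hε).le (lt_of_le_of_lt ?_ hN)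
    rw [PiLp.norm_sq_eq_of_L2]
    refine Finset.sum_le_sum fun e _ => ?_
    have hL := Γ.length_pos e
    have hsub : (w.1 - step a) e =ᵐ[Γ.edgeMeasure e] fun x => w.1 e x - step a e x :=
      Lp.coeFn_sub _ _
    rw [Γ.norm_sq_edge hsub]
    have hpt : ∀ᵐ x ∂Γ.edgeMeasure e, ‖w.1 e x - step a e x‖ ^ 2 ≤
        Γ.length e / N * r ^ 2 := by
      filter_upwards [hstep a e, hw.ae_eq e, ae_restrict_mem measurableSet_Icc] with x h1 h2 hx
      have hx0 : 0 ≤ x * N / Γ.length e := div_nonneg (mul_nonneg hx.1 hNr.le) hL.le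
      have hj : ⌊x * N / Γ.length e⌋₊ < N + 1 := by
        rw [Nat.lt_succ_iff]
        refine Nat.floor_le_of_le ?_
        rw [div_le_iff₀ hL, mul_comm]
        exact mul_le_mul_of_nonneg_left hx.2 hNr.le
      rw [h2, h1 ⟨_, hj⟩ rfl]
      refine (norm_sub_sq_le_of_primitive (hw.hasH1Deriv e).1 (hw.hasH1Deriv e).2
        (hnode e ⟨_, hj⟩) hx).trans ?_
      rw [← Γ.norm_sq_edge (hw.deriv_ae_eq e)]
      have h3 : ‖w.2.1 e‖ ≤ r := (PiLp.norm_apply_le w.2.1 e).trans hwr'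
      have hnx : node e ⌊x * N / Γ.length e⌋₊ ≤ x := by
        have := Nat.floor_le hx0
        calc (⌊x * N / Γ.length e⌋₊ : ℝ) * (Γ.length e / N) ≤
            x * N / Γ.length e * (Γ.length e / N) := by gcongr
          _ = x := by field_simp
      have hxn : x ≤ node e ⌊x * N / Γ.length e⌋₊ + Γ.length e / N := by
        have := Nat.lt_floor_add_one (x * N / Γ.length e)
        calc x = x * N / Γ.length e * (Γ.length e / N) := by field_simp
          _ ≤ (⌊x * N / Γ.length e⌋₊ + 1) * (Γ.length e / N) := by gcongr
          _ = _ := by simp only [node]; ring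
      gcongr
      change |x - node e ⌊x * N / Γ.length e⌋₊| ≤ _
      rw [abs_of_nonneg (by linarith)]
      linarith
    calc ∫ x in Icc 0 (Γ.length e), ‖w.1 e x - step a e x‖ ^ 2
        ≤ ∫ _ in Icc 0 (Γ.length e), Γ.length e / N * r ^ 2 :=
          integral_mono_of_nonneg (Eventually.of_forall fun x => sq_nonneg _)
            (integrable_const _) hpt
      _ = Γ.length e * (Γ.length e / N * r ^ 2) := by
          rw [setIntegral_const, Real.volume_real_Icc_of_le hL.le, sub_zero, smul_eq_mul]
  obtain ⟨y, hy, hay⟩ := mem_iUnion₂.1 (hcov (mem_image_of_mem step haK))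
  refine mem_iUnion₂.2 ⟨y, hy, ?_⟩
  rw [Metric.mem_ball] at hay ⊢
  have := dist_triangle w.1 (step a) y
  rw [dist_eq_norm w.1 (step a)] at this
  linarith

/-- With `γ = C + 1`, where `C` is the semiboundedness constant, the form of `H + γ` dominates
`‖f'‖² / 2 + ‖f‖²`. This gives the bound, injectivity and hence surjectivity, and `H¹` control for
Rellich's theorem. -/
theorem exists_isCompactlyInvertible [Fintype V] :
    ∃ γ, IsCompactlyInvertible Γ.hamiltonianGraph γ := by
  obtain ⟨S, hS, hSrel⟩ := Γ.exists_boundaryForm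
  obtain ⟨C, hC⟩ := Γ.exists_le_energyForm S
  have hform : ∀ f g, Γ.HamiltonianRel f g → ∀ f₂ g₂, Γ.HamiltonianRel f₂ g₂ →
      ⟪g, f₂⟫_ℂ = ⟪f, g₂⟫_ℂ := by
    intro f g h f₂ g₂ h₂
    obtain ⟨w, u, u', F', hw, rfl, hwF, hwg⟩ := h.exists_isH1Data
    obtain ⟨v, y, y', G', hv, rfl, hvG, hvg⟩ := h₂.exists_isH1Data
    rw [← inner_conj_symm w.1, hwg v y y' hv, hvg w u u' hw, hSrel _ hwF _ hvG,
      hSrel _ hvG _ hwF, ← energyForm_apply, ← energyForm_apply, energyForm_conj hS hv hw]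
  have hbound : ∀ f g, Γ.HamiltonianRel f g → ∃ (w : Γ.H1Space) (u u' : E → ℝ → ℂ),
      Γ.IsH1Data w u u' ∧ w.1 = f ∧
      ‖w.2.1‖ ^ 2 / 2 + ‖f‖ ^ 2 ≤ (⟪f, g + ((C + 1 : ℝ) : ℂ) • f⟫_ℂ).re := by
    intro f g h
    obtain ⟨w, u, u', F', hw, rfl, hwF, hwg⟩ := h.exists_isH1Data
    refine ⟨w, u, u', hw, rfl, ?_⟩
    have h1 := hC w u u' hw
    have h2 := hwg w u u' hw
    rw [hSrel _ hwF _ hwF, ← energyForm_apply] at h2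
    rw [inner_add_right, inner_smul_right, inner_self_eq_norm_sq_to_K, ← hform _ _ h _ _ h, h2,
      Complex.add_re]
    have h3 : (((C + 1 : ℝ) : ℂ) * ((‖w.1‖ : ℝ) : ℂ) ^ 2).re = (C + 1) * ‖w.1‖ ^ 2 := by
      rw [← Complex.ofReal_pow, ← Complex.ofReal_mul, Complex.ofReal_re]
    have h4 : (((C + 1 : ℝ) : ℂ) * ((‖w.1‖ : ℝ) : ℂ) ^ 2).re ≤
      (((C + 1 : ℝ) : ℂ) * (RCLike.ofReal ‖w.1‖ : ℂ) ^ 2).re := le_rfl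
    linarith
  refine ⟨C + 1, ⟨fun p hp q hq => hform _ _ hp _ _ hq, fun p hp => ?_, fun g => ?_, fun g hg =>
    Γ.hamiltonianGraph_functional _ hg rfl, ?_⟩⟩
  · obtain ⟨w, u, u', -, -, h1⟩ := hbound _ _ hp
    linarith [sq_nonneg ‖w.2.1‖]
  · refine Γ.exists_hamiltonianRel_of_injective (C + 1) (fun f hf => ?_) g
    obtain ⟨w, u, u', -, -, h1⟩ := hbound _ _ hf
    rw [neg_add_cancel, inner_zero_right, Complex.zero_re] at h1
    have : ‖f‖ ^ 2 ≤ 0 := by linarith [sq_nonneg ‖w.2.1‖]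
    exact norm_eq_zero.1 (pow_eq_zero_iff two_ne_zero |>.1 (le_antisymm this (sq_nonneg _)))
  -- If `‖(H + γ) f‖ ≤ 1`, then `‖f‖ ≤ 1` and `‖f'‖² ≤ 2`, so the radius 2 suffices.
  · refine (Γ.totallyBounded_isH1Data 2).subset ?_
    rintro f ⟨g, hfg, hg⟩
    obtain ⟨w, u, u', hw, rfl, h1⟩ := hbound _ _ hfg
    refine ⟨w, u, u', hw, rfl, ?_⟩
    have h2 : (⟪w.1, g + ((C + 1 : ℝ) : ℂ) • w.1⟫_ℂ).re ≤ ‖w.1‖ * 1 :=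
      ((Complex.re_le_norm _).trans (norm_inner_le_norm _ _)).trans (by gcongr)
    have h3 : ‖w.1‖ ≤ 1 := by nlinarith [sq_nonneg ‖w.2.1‖, norm_nonneg w.1]
    refine ⟨by linarith, ?_⟩
    nlinarith [norm_nonneg w.2.1, sq_nonneg ‖w.1‖]

end QuantumGraph

/-! ### Eigenvalues of the Hamiltonian and the comparison of two graphs. -/

namespace QuantumGraph

open scoped InnerProductSpace ComplexConjugate
open Module Filter Topology

variable {V E : Type*} [DecidableEq V] [Fintype E] (Γ : QuantumGraph V E)

/-- Polynomials embed: one that vanishes almost everywhere on an edge has infinitely many roots. -/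
theorem not_finiteDimensional_L2Space [Nonempty E] : ¬ FiniteDimensional ℂ Γ.L2Space := by
  intro hfd
  have hc : ∀ (p : Polynomial ℂ) (e : E),
      ContinuousOn (fun x : ℝ => p.eval (x : ℂ)) (Icc 0 (Γ.length e)) := fun p e =>
    (p.continuous.comp Complex.continuous_ofReal).continuousOn
  have hm := fun p e => Γ.memLp_of_continuousOn (hc p e) 2
  let J : Polynomial ℂ →ₗ[ℂ] Γ.L2Space :=
    { toFun := fun p => WithLp.toLp 2 fun e => (hm p e).toLp
      map_add' := fun p q => by
        refine PiLp.ext fun e => ?_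
        rw [PiLp.add_apply, ← MemLp.toLp_add]
        exact (hm (p + q) e).toLp_congr ((hm p e).add (hm q e))
          (Eventually.of_forall fun x => by simp)
      map_smul' := fun c p => by
        refine PiLp.ext fun e => ?_
        rw [RingHom.id_apply, PiLp.smul_apply, ← MemLp.toLp_const_smul]
        exact (hm (c • p) e).toLp_congr ((hm p e).const_smul c)
          (Eventually.of_forall fun x => by simp) }
  have hJ : Function.Injective J := by
    rw [← LinearMap.ker_eq_bot, eq_bot_iff]
    intro p hp
    obtain ⟨e⟩ := ‹Nonempty E›
    have hL := Γ.length_pos e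
    have h1 : (hm p e).toLp = 0 := by
      have := congrArg (fun f : Γ.L2Space => f e) (LinearMap.mem_ker.1 hp)
      exact this
    have h2 : (fun x : ℝ => p.eval (x : ℂ)) =ᵐ[Γ.edgeMeasure e] 0 :=
      ((hm p e).coeFn_toLp).symm.trans
        (by rw [h1]; exact Lp.coeFn_zero ℂ 2 _)
    have h3 := Measure.eqOn_Icc_of_ae_eq volume hL.ne h2 (hc p e) continuousOn_const
    refine Polynomial.eq_zero_of_infinite_isRoot p ?_
    refine ((Icc_infinite hL).image Complex.ofReal_injective.injOn).mono ?_
    rintro _ ⟨x, hx, rfl⟩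
    exact h3 hx
  have := Module.Finite.of_injective J hJ
  exact Polynomial.not_finite this

theorem eigenspace_eq (μ : ℂ) : Γ.eigenspace μ = relEigenspace Γ.hamiltonianGraph μ := by
  ext f
  rw [mem_relEigenspace, ← hamiltonian_graph, LinearPMap.mem_graph_iff, eigenspace,
    Submodule.mem_map]
  constructor
  · rintro ⟨y, hy, rfl⟩
    exact ⟨y, rfl, sub_eq_zero.1 hy⟩
  · rintro ⟨y, rfl, hy⟩
    exact ⟨y, sub_eq_zero.2 hy, rfl⟩

theorem isEigenvalueSequence_iff (lam : ℕ → ℝ) :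
    Γ.IsEigenvalueSequence lam ↔ IsRelEigenvalueSequence Γ.hamiltonianGraph lam := by
  refine and_congr Iff.rfl (forall_congr' fun μ => ?_)
  rw [eigenspace_eq]

theorem exists_isEigenvalueSequence [Fintype V] [Nonempty E] :
    ∃ lam, Γ.IsEigenvalueSequence lam := by
  obtain ⟨γ, hγ⟩ := Γ.exists_isCompactlyInvertible
  obtain ⟨lam, hlam⟩ := hγ.exists_eigenvalueSequence Γ.not_finiteDimensional_L2Space
  exact ⟨lam, (Γ.isEigenvalueSequence_iff lam).2 hlam⟩

variable {Γ}

/-- The trace of an `H¹` function depends only on its `L²` class, since a continuous representative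
that vanishes almost everywhere on an edge vanishes on all of it. -/
theorem IsH1Data.boundary_eq_of_eq {v w : Γ.H1Space} {u u' y y' : E → ℝ → ℂ}
    (hv : Γ.IsH1Data v u u') (hw : Γ.IsH1Data w y y') (h : v.1 = w.1) : v.2.2.2 = w.2.2.2 := by
  have hd := hv.add (hw.smul (-1))
  have h0 : (v + (-1 : ℂ) • w).1 = 0 := by
    rw [Prod.fst_add, Prod.smul_fst, h, neg_smul, one_smul, add_neg_cancel]
  have hz : ∀ e, ∀ x ∈ Icc 0 (Γ.length e), (u + (-1 : ℂ) • y) e x = 0 := fun e => by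
    have h1 := hd.ae_eq e
    rw [h0] at h1
    exact (HasH1Deriv.ae_eq_zero Γ (hd.hasH1Deriv e)
      (h1.symm.trans (Lp.coeFn_zero ℂ 2 (Γ.edgeMeasure e)))).1
  have hb := hd.boundary_eq
  have hb0 : Γ.boundaryValue (u + (-1 : ℂ) • y) = 0 := by
    ext ⟨e, _ | _⟩
    · exact hz e 0 ⟨le_rfl, (Γ.length_pos e).le⟩
    · exact hz e _ ⟨(Γ.length_pos e).le, le_rfl⟩
  rw [hb0, WithLp.toLp_zero, Prod.snd_add, Prod.snd_add, Prod.snd_add, Prod.smul_snd,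
    Prod.smul_snd, Prod.smul_snd, neg_smul, one_smul, add_neg_eq_zero] at hb
  exact hb

variable (Γ)

/-- The `H¹` functions on the edges. -/
noncomputable def h1Data : Submodule ℂ Γ.H1Space where
  carrier := {w | ∃ u u', Γ.IsH1Data w u u'}
  zero_mem' := by
    obtain ⟨w, u, u', F', hw, -⟩ := (HamiltonianRel.zero Γ).exists_isH1Data
    exact ⟨_, _, by simpa using hw.smul 0⟩
  add_mem' := by
    rintro _ _ ⟨u, u', h⟩ ⟨y, y', k⟩
    exact ⟨_, _, h.add k⟩
  smul_mem' := by
    rintro c _ ⟨u, u', h⟩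
    exact ⟨_, _, h.smul c⟩

/-- The domain of the quadratic form of the Hamiltonian. -/
noncomputable def formDomain : Submodule ℂ Γ.H1Space :=
  Γ.h1Data ⊓ (Γ.boundaryRelation.map (LinearMap.fst ℂ _ _)).comap
    (LinearMap.snd ℂ _ _ ∘ₗ LinearMap.snd ℂ _ _ ∘ₗ LinearMap.snd ℂ _ _)

theorem mem_formDomain {w : Γ.H1Space} : w ∈ Γ.formDomain ↔
    (∃ u u', Γ.IsH1Data w u u') ∧ ∃ F', (w.2.2.2, F') ∈ Γ.boundaryRelation := by
  refine and_congr Iff.rfl ⟨?_, ?_⟩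
  · rintro ⟨⟨F, F'⟩, h, hF⟩
    exact ⟨F', by rw [← show F = w.2.2.2 from hF]; exact h⟩
  · rintro ⟨F', h⟩
    exact ⟨_, h, rfl⟩

/-- Lower bound for the form on the functions in the form domain that are orthogonal to the first
eigenfunctions. -/
theorem exists_eigenfunctions_le_energyForm [Fintype V] {lam : ℕ → ℝ}
    (hlam : Γ.IsEigenvalueSequence lam) : ∃ φ : ℕ → Γ.L2Space, Orthonormal ℂ φ ∧
      (∀ n, Γ.HamiltonianRel (φ n) ((lam n : ℂ) • φ n)) ∧
      ∀ (n : ℕ) (w : Γ.H1Space) (u u' : E → ℝ → ℂ) (G' : EuclideanSpace ℂ (E × Bool)),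
        Γ.IsH1Data w u u' → (w.2.2.2, G') ∈ Γ.boundaryRelation →
        (∀ m < n, ⟪φ m, w.1⟫_ℂ = 0) →
        lam n * ‖w.1‖ ^ 2 ≤
          (⟪w.2.1, w.2.1⟫_ℂ + ⟪w.2.2.1, w.1⟫_ℂ + ⟪G', w.2.2.2⟫_ℂ).re := by
  obtain ⟨γ, hγ⟩ := Γ.exists_isCompactlyInvertible
  obtain ⟨φ, hφ, hφT, hcompl⟩ := hγ.exists_orthonormal_eigenvectors
    ((Γ.isEigenvalueSequence_iff lam).1 hlam)
  obtain ⟨S, hS, hSrel⟩ := Γ.exists_boundaryForm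
  obtain ⟨C, hC⟩ := Γ.exists_le_energyForm S
  refine ⟨φ, hφ, hφT, fun n w u u' G' hw hG hortho => ?_⟩
  choose Φ v v' F' hΦ hΦφ hF' hgreen using fun n => (hφT n).exists_isH1Data
  rw [hSrel _ hG _ hG, ← energyForm_apply]
  let W := Γ.formDomain
  exact le_form_of_orthogonal (W := W) (LinearMap.fst ℂ _ _ ∘ₗ W.subtype)
    (((Γ.energyForm S).compl₂ W.subtype) ∘ₛₗ W.subtype)
    (fun x y => by
      obtain ⟨⟨_, _, hx⟩, -⟩ := Γ.mem_formDomain.1 x.2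
      obtain ⟨⟨_, _, hy⟩, -⟩ := Γ.mem_formDomain.1 y.2
      exact energyForm_conj hS hx hy) C
    (fun x => by
      obtain ⟨⟨_, _, hx⟩, -⟩ := Γ.mem_formDomain.1 x.2
      have h1 := hC _ _ _ hx
      have h2 := sq_nonneg ‖(x : Γ.H1Space).2.1‖
      change -C * ‖(x : Γ.H1Space).1‖ ^ 2 ≤ (Γ.energyForm S x x).re
      linarith) hφ hcompl hlam.1
    (fun n => ⟨Φ n, Γ.mem_formDomain.2 ⟨⟨_, _, hΦ n⟩, _, hF' n⟩⟩) hΦφ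
    (fun n y => by
      obtain ⟨⟨_, _, hy⟩, G, hyG⟩ := Γ.mem_formDomain.1 y.2
      have h1 := hgreen n _ _ _ hy
      rw [hSrel _ (hF' n) _ hyG, ← energyForm_apply, inner_smul_left, Complex.conj_ofReal] at h1
      exact h1.symm) (n := n)
    (w := ⟨w, Γ.mem_formDomain.2 ⟨⟨u, u', hw⟩, G', hG⟩⟩) hortho

/-- Comparison of two Hamiltonians with the same edges and the same potential: if, up to finitely
many linear conditions, the form domain of the first contains the operator domain of the second
and the forms agree there, then the eigenvalues of the first lie below those of the second. -/
theorem eigenvalue_le_of_boundaryRelation [Fintype V] {V' : Type*} [Fintype V'] [DecidableEq V']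
    (Γ' : QuantumGraph V' E) (hlen : Γ'.length = Γ.length) (hpot : Γ'.potential = Γ.potential)
    {Y : Type*} [AddCommGroup Y] [Module ℂ Y] [FiniteDimensional ℂ Y]
    (c : EuclideanSpace ℂ (E × Bool) →ₗ[ℂ] Y)
    (hc : ∀ F F', (F, F') ∈ Γ'.boundaryRelation → c F = 0 →
      ∃ G', (F, G') ∈ Γ.boundaryRelation ∧ ⟪G', F⟫_ℂ = ⟪F', F⟫_ℂ)
    {lam lam' : ℕ → ℝ} (hlam : Γ.IsEigenvalueSequence lam) (hlam' : Γ'.IsEigenvalueSequence lam')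
    (n : ℕ) : lam n ≤ lam' (n + finrank ℂ Y) := by
  -- Substituting lengths and potential makes the `L²` and `H¹` spaces of both graphs definitionally
  -- equal, so vectors can pass from one to the other.
  obtain ⟨⟨origin', len', hlen'⟩, pot', hpot', A', B', hr', hh'⟩ := Γ'
  obtain rfl : len' = Γ.length := hlen
  obtain rfl : pot' = Γ.potential := hpot
  let Γ' : QuantumGraph V' E := ⟨⟨origin', Γ.length, hlen'⟩, Γ.potential, hpot', A', B', hr', hh'⟩
  replace hc : ∀ F F', (F, F') ∈ Γ'.boundaryRelation → c F = 0 →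
    ∃ G', (F, G') ∈ Γ.boundaryRelation ∧ ⟪G', F⟫_ℂ = ⟪F', F⟫_ℂ := hc
  replace hlam' : Γ'.IsEigenvalueSequence lam' := hlam'
  obtain ⟨φ, hφ, -, hlow⟩ := Γ.exists_eigenfunctions_le_energyForm hlam
  obtain ⟨φ', hφ', hφT', -⟩ := Γ'.exists_eigenfunctions_le_energyForm hlam'
  choose w y y' F' hw hwφ hwF hgreen using fun n => (hφT' n).exists_isH1Data
  let sum₀ : (Fin (n + finrank ℂ Y + 1) → ℂ) →ₗ[ℂ] Γ'.H1Space :=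
    Fintype.linearCombination ℂ (fun i => w i)
  let sumF : (Fin (n + finrank ℂ Y + 1) → ℂ) →ₗ[ℂ] Γ.H1Space := sum₀
  -- The conditions on the coefficients: orthogonality to the first `n` eigenfunctions of `Γ`, and
  -- the constraint `c` on the boundary values.
  let l : (Fin (n + finrank ℂ Y + 1) → ℂ) →ₗ[ℂ] (Fin n → ℂ) × Y :=
    LinearMap.prod
      (LinearMap.pi fun m => (innerSL ℂ (φ m)).toLinearMap ∘ₗ LinearMap.fst ℂ _ _ ∘ₗ sumF)
      (c ∘ₗ LinearMap.snd ℂ _ _ ∘ₗ LinearMap.snd ℂ _ _ ∘ₗ LinearMap.snd ℂ _ _ ∘ₗ sumF)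
  obtain ⟨z, hz, hf0, hfT, hle⟩ := exists_combination_eigenvectors (T := Γ'.hamiltonianGraph) hφ'
    hlam'.1 hφT' (N := n + finrank ℂ Y) (by simp) l
  set f := ∑ i : Fin (n + finrank ℂ Y + 1), z i • φ' i with hf
  have hwmem : ∀ i, w i ∈ Γ'.h1Data := fun i => ⟨_, _, hw i⟩
  have hsum₀ : sum₀ z = ∑ i : Fin (n + finrank ℂ Y + 1), z i • w i :=
    Fintype.linearCombination_apply ℂ _ _
  have hsumF : sum₀ z ∈ Γ'.h1Data := by
    rw [hsum₀]
    exact Γ'.h1Data.sum_mem fun i _ => Γ'.h1Data.smul_mem _ (hwmem i)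
  have hsumf : (sum₀ z).1 = f := by
    rw [hsum₀, Prod.fst_sum]
    exact Finset.sum_congr rfl fun i _ => by rw [Prod.smul_fst, hwφ]
  obtain ⟨x, u, u', X', hx, hxf, hxX, hxg⟩ := HamiltonianRel.exists_isH1Data hfT
  obtain ⟨s, s', hs⟩ := hsumF
  -- The constraint was imposed on the sum of the data of the eigenfunctions, while the outgoing
  -- derivatives come from the data `x` of the sum. Both have the same trace.
  have hbd : x.2.2.2 = (sum₀ z).2.2.2 := hx.boundary_eq_of_eq hs (hxf.trans hsumf.symm)
  have hz1 : ∀ m < n, ⟪φ m, f⟫_ℂ = 0 := fun m hm => by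
    have h1 := congrFun (congrArg Prod.fst hz) ⟨m, hm⟩
    rw [← hsumf]
    exact h1
  have hz2 : c x.2.2.2 = 0 := by
    rw [hbd]
    exact congrArg Prod.snd hz
  obtain ⟨G', hG, hGX⟩ := hc _ _ hxX hz2
  have hxΓ : Γ.IsH1Data x u u' := by
    refine ⟨hx.ae_eq, hx.hasH1Deriv, hx.deriv_ae_eq, hx.potential_ae_eq, ?_⟩
    rw [hx.boundary_eq]
    congr 1
  have h1 := hlow n x u u' G' hxΓ hG (fun m hm => by rw [hxf]; exact hz1 m hm)
  have h2 := hxg x u u' hx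
  rw [hGX] at h1
  have e1 : lam n * ‖f‖ ^ 2 = lam n * ‖x.1‖ ^ 2 := by rw [hxf]
  have e2 : (⟪x.2.1, x.2.1⟫_ℂ + ⟪x.2.2.1, x.1⟫_ℂ + ⟪X', x.2.2.2⟫_ℂ).re ≤
      lam' (n + finrank ℂ Y) * ‖f‖ ^ 2 := by
    rw [← h2, ← inner_conj_symm, Complex.conj_re, hxf]
    exact hle
  have h3 : lam n * ‖f‖ ^ 2 ≤ lam' (n + finrank ℂ Y) * ‖f‖ ^ 2 := e1.le.trans (h1.trans e2)
  exact le_of_mul_le_mul_right h3 (by positivity)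

end QuantumGraph

/-! ### Boundary data under gluing. -/

namespace QuantumGraph

open scoped InnerProductSpace ComplexConjugate
open Module Filter Topology

variable {V V' E : Type*} [DecidableEq V] [DecidableEq V'] [Fintype E]
  {Γ : QuantumGraph V E} {Γ' : QuantumGraph V' E} {q : V → V'} {α : V → ℝ}

theorem vertexCondition_congr {v : V} {F F' G' : E × Bool → ℂ}
    (h : ∀ b : Γ.BondsAt v, F' b.1 = G' b.1) :
    (F, F') ∈ Γ.vertexCondition v ↔ (F, G') ∈ Γ.vertexCondition v := by
  have e : (fun b : Γ.BondsAt v => F' b.1) = fun b => G' b.1 := funext h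
  simp only [vertexCondition, mem_ofPred_eq, e]

namespace IsGluing

variable [Fintype V]

theorem sum_bonds (h : IsGluing Γ Γ' q α) (w : V') (f : E × Bool → ℂ) :
    ∑ b : Γ'.BondsAt w, f b.1 = ∑ v with q v = w, ∑ b : Γ.BondsAt v, f b.1 := by
  have h1 : ∀ v, ∑ b : Γ.BondsAt v, f b.1 = ∑ b with Γ.origin b = v, f b := fun v =>
    (Finset.sum_subtype _ (fun b => by simp) f).symm
  have h2 : ∑ b : Γ'.BondsAt w, f b.1 = ∑ b with Γ'.origin b = w, f b :=
    (Finset.sum_subtype _ (fun b => by simp) f).symm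
  rw [h2]
  simp only [h1]
  rw [← Finset.sum_fiberwise_of_maps_to (g := Γ.origin) (t := {v | q v = w})]
  · refine Finset.sum_congr rfl fun v hv => ?_
    refine Finset.sum_congr ?_ fun _ _ => rfl
    ext b
    simp only [Finset.mem_filter, Finset.mem_univ, true_and, h.origin_eq] at hv ⊢
    constructor
    · exact fun hb => hb.2
    · rintro rfl
      exact ⟨hv, rfl⟩
  · intro b hb
    simpa [h.origin_eq] using hb

/-- The boundary values in the domain of the glued graph are in the form domain of the original
graph, and the forms agree. -/
theorem exists_boundaryRelation [Fintype V'] (h : IsGluing Γ Γ' q α)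
    {F F' : EuclideanSpace ℂ (E × Bool)} (hF : (F, F') ∈ Γ'.boundaryRelation) :
    ∃ G', (F, G') ∈ Γ.boundaryRelation ∧ ⟪G', F⟫_ℂ = ⟪F', F⟫_ℂ := by
  classical
  let unglued : V → Prop := fun v => ∀ w, q w = q v → w = v
  -- At a glued vertex `F` is constant, so only the sum of the derivatives matters. The required
  -- total `α v * c` is spread evenly over the bonds, which is possible because the degree is
  -- positive.
  let G' : EuclideanSpace ℂ (E × Bool) := WithLp.toLp 2 fun b =>
    if unglued (Γ.origin b) then F' b else
      α (Γ.origin b) * F b / Fintype.card (Γ.BondsAt (Γ.origin b))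
  have hG1 : ∀ v, unglued v → ∀ b : Γ.BondsAt v, G' b.1 = F' b.1 := by
    rintro v hv ⟨b, rfl⟩
    exact if_pos hv
  have hG2 : ∀ v, ¬ unglued v → ∀ b : Γ.BondsAt v,
      G' b.1 = α v * F b.1 / Fintype.card (Γ.BondsAt v) := by
    rintro v hv ⟨b, rfl⟩
    exact if_neg hv
  have hglued : ∀ v, ¬ unglued v → Nonempty (Γ.BondsAt v) ∧ Γ.IsDelta v (α v) ∧
      Γ'.IsDelta (q v) (∑ x with q x = q v, α x) := by
    intro v hv
    obtain ⟨w, hw⟩ := not_forall.1 hv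
    obtain ⟨hw1, hw2⟩ := Classical.not_imp.1 hw
    exact h.glued v w hw2 hw1
  have hsumG : ∀ v, ¬ unglued v → ∀ c : ℂ, (∀ b : Γ.BondsAt v, F b.1 = c) →
      ∑ b : Γ.BondsAt v, G' b.1 = α v * c := by
    intro v hv c hc
    have := (hglued v hv).1
    have hcard : (Fintype.card (Γ.BondsAt v) : ℂ) ≠ 0 := by
      exact_mod_cast Fintype.card_ne_zero
    rw [Finset.sum_congr rfl fun b _ => hG2 v hv b]
    simp only [hc, Finset.sum_const, Finset.card_univ, nsmul_eq_mul]
    field_simp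
  have hconst : ∀ v, ¬ unglued v → ∃ c : ℂ, (∀ b, q (Γ.origin b) = q v → F b = c) ∧
      ∑ b : Γ'.BondsAt (q v), F' b.1 = ((∑ x with q x = q v, α x : ℝ) : ℂ) * c := by
    intro v hv
    obtain ⟨c, hc, hs⟩ := ((hglued v hv).2.2 F F').1 (hF (q v))
    exact ⟨c, fun b hb => hc ⟨b, by rw [h.origin_eq]; exact hb⟩, hs⟩
  refine ⟨G', fun v => ?_, ?_⟩
  · by_cases hv : unglued v
    · refine (vertexCondition_congr (hG1 v hv)).2 ?_
      rw [← h.unglued v hv]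
      exact hF (q v)
    · obtain ⟨c, hc, -⟩ := hconst v hv
      have hcv : ∀ b : Γ.BondsAt v, F b.1 = c := fun b => hc b.1 (by rw [b.2])
      exact ((hglued v hv).2.1 F G').2 ⟨c, hcv, hsumG v hv c hcv⟩
  · rw [Γ'.inner_eq_sum_vertices, Γ'.inner_eq_sum_vertices]
    refine Finset.sum_congr rfl fun w _ => ?_
    obtain ⟨v, rfl⟩ := h.surjective w
    by_cases hv : unglued v
    · refine Finset.sum_congr rfl fun b _ => ?_
      have hb : Γ.origin b.1 = v := hv _ (by rw [← h.origin_eq]; exact b.2)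
      rw [hG1 v hv ⟨b.1, hb⟩]
    · obtain ⟨c, hc, hs⟩ := hconst v hv
      have hcb : ∀ b : Γ'.BondsAt (q v), F b.1 = c := fun b =>
        hc b.1 (by rw [← h.origin_eq]; exact b.2)
      simp only [hcb]
      rw [← Finset.sum_mul, ← Finset.sum_mul, ← star_sum, ← star_sum, hs,
        h.sum_bonds (q v) (fun b => G' b), Complex.ofReal_sum, Finset.sum_mul]
      -- What remains is the additivity of the δ coefficients over the class.
      congr 2
      refine Finset.sum_congr rfl fun x hx => ?_
      have hxv : q x = q v := by simpa using hx
      have hxu : ¬ unglued x := fun hu => hv fun w hw => by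
        rw [hu w (hw.trans hxv.symm), hu v hxv.symm]
      exact hsumG x hxu c fun b => hc b.1 (by rw [b.2, hxv])

/-- The boundary data in the domain of the original graph that are continuous at the glued vertices
belong to the domain of the glued graph. -/
theorem exists_constraints [Fintype V'] (h : IsGluing Γ Γ' q α) {k : ℕ}
    (hk : Fintype.card V = Fintype.card V' + k) :
    ∃ c : EuclideanSpace ℂ (E × Bool) →ₗ[ℂ] (Fin k → ℂ), ∀ F F',
      (F, F') ∈ Γ.boundaryRelation → c F = 0 → (F, F') ∈ Γ'.boundaryRelation := by
  classical
  -- `σ` picks a representative of each class. Each of the `k` other vertices gives one constraint: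
  -- its value equals that of its representative.
  obtain ⟨σ, hσ⟩ := h.surjective.hasRightInverse
  let K := {v : V // ¬ v = σ (q v)}
  have hcard : Fintype.card K = k := by
    have h1 : Fintype.card {v : V // v = σ (q v)} = Fintype.card V' :=
      Fintype.card_congr
        { toFun := fun v => q v.1
          invFun := fun w => ⟨σ w, by rw [hσ]⟩
          left_inv := fun v => Subtype.ext v.2.symm
          right_inv := fun w => hσ w }
    rw [Fintype.card_subtype_compl, h1, hk]
    omega
  let e : Fin k ≃ K := (Fintype.equivFinOfCardEq hcard).symm
  -- The default `0` at an isolated vertex is harmless: such a vertex is never glued, so it is its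
  -- own representative.
  let val : V → EuclideanSpace ℂ (E × Bool) →ₗ[ℂ] ℂ := fun v =>
    if hv : Nonempty (Γ.BondsAt v) then (EuclideanSpace.proj hv.some.1).toLinearMap else 0
  have hval : ∀ v (F : EuclideanSpace ℂ (E × Bool)) (c : ℂ), Nonempty (Γ.BondsAt v) →
      (∀ b : Γ.BondsAt v, F b.1 = c) → val v F = c := fun v F c hv hc => by
    simp only [val, dif_pos hv]
    exact hc hv.some
  refine ⟨LinearMap.pi fun i => val (e i).1 - val (σ (q (e i).1)), fun F F' hF hc w => ?_⟩
  have hc' : ∀ v, val v F = val (σ (q v)) F := fun v => by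
    by_cases hv : v = σ (q v)
    · rw [← hv]
    · have h1 := congrFun hc (e.symm ⟨v, hv⟩)
      simp only [LinearMap.pi_apply, LinearMap.sub_apply, Equiv.apply_symm_apply,
        Pi.zero_apply, sub_eq_zero] at h1
      exact h1
  obtain ⟨v, rfl⟩ := h.surjective w
  by_cases hv : ∀ w, q w = q v → w = v
  · rw [h.unglued v hv]
    exact hF v
  · obtain ⟨w, hw⟩ := not_forall.1 hv
    obtain ⟨hw1, hw2⟩ := Classical.not_imp.1 hw
    have hglued : ∀ x, q x = q v → Nonempty (Γ.BondsAt x) ∧ Γ.IsDelta x (α x) := by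
      intro x hx
      by_cases hxv : x = v
      · rw [hxv]
        exact ⟨(h.glued v w hw2 hw1).1, (h.glued v w hw2 hw1).2.1⟩
      · have := h.glued x v (fun h => hxv h.symm) hx.symm
        exact ⟨this.1, this.2.1⟩
    have hx : ∀ x, q x = q v → (∀ b : Γ.BondsAt x, F b.1 = val (σ (q v)) F) ∧
        ∑ b : Γ.BondsAt x, F' b.1 = α x * val (σ (q v)) F := by
      intro x hx
      obtain ⟨hne, hδ⟩ := hglued x hx
      obtain ⟨c, hc1, hc2⟩ := (hδ F F').1 (hF x)
      have h1 := hval x F c hne hc1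
      rw [hc' x, hx] at h1
      rw [h1]
      exact ⟨hc1, hc2⟩
    refine ((h.glued v w hw2 hw1).2.2 F F').2 ⟨val (σ (q v)) F, fun b => ?_, ?_⟩
    · have hb : q (Γ.origin b.1) = q v := by rw [← h.origin_eq]; exact b.2
      exact (hx _ hb).1 ⟨b.1, rfl⟩
    · rw [h.sum_bonds (q v) (fun b => F' b), Complex.ofReal_sum, Finset.sum_mul]
      refine Finset.sum_congr rfl fun x hxm => ?_
      exact (hx x (by simpa using hxm)).2

end IsGluing

end QuantumGraph

theorem theorem5p4 {V V' E : Type*} [Fintype V] [DecidableEq V] [Fintype V'] [DecidableEq V']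
    [Fintype E] [Nonempty E] (Γ : QuantumGraph V E) (Γ' : QuantumGraph V' E)
    (q : V → V') (α : V → ℝ) (hglue : QuantumGraph.IsGluing Γ Γ' q α)
    (k : ℕ) (hk : Fintype.card V = Fintype.card V' + k) :
    (∃ lam : ℕ → ℝ, Γ.IsEigenvalueSequence lam) ∧
    (∃ lam' : ℕ → ℝ, Γ'.IsEigenvalueSequence lam') ∧
    ∀ lam lam' : ℕ → ℝ, Γ.IsEigenvalueSequence lam → Γ'.IsEigenvalueSequence lam' →
      ∀ n : ℕ, lam n ≤ lam' n ∧ lam' n ≤ lam (n + k) := by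
  refine ⟨Γ.exists_isEigenvalueSequence, Γ'.exists_isEigenvalueSequence,
    fun lam lam' hlam hlam' n => ⟨?_, ?_⟩⟩
  -- No constraint is needed here, so `Y` is the zero-dimensional space.
  · have h := Γ.eigenvalue_le_of_boundaryRelation Γ' hglue.length_eq hglue.potential_eq
      (0 : EuclideanSpace ℂ (E × Bool) →ₗ[ℂ] (Fin 0 → ℂ))
      (fun F F' hF _ => hglue.exists_boundaryRelation hF) hlam hlam' n
    simpa using h
  -- With the roles exchanged, the `k` continuity constraints shift the index by `k`; the derivative
  -- data are kept as they are.
  · obtain ⟨c, hc⟩ := hglue.exists_constraints hk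
    have h := Γ'.eigenvalue_le_of_boundaryRelation Γ hglue.length_eq.symm hglue.potential_eq.symm c
      (fun F F' hF h0 => ⟨F', hc F F' hF h0, rfl⟩) hlam' hlam n
    simpa using h
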